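/- \textbf{Setting.} For integers $N_1,N_2,N_3\ge 1$ and $c>0$, take an $N_1\times N_2\times N_3$ grid of blocks spanned by $c\,v_x,\ c\,v_y,\ c\,v_z$ with $v_x=(1,-\tfrac13,0)$, $v_y=(0,1,0)$, $v_z=(-\tfrac13,-\tfrac29,1)$ (each block has volume $c^3$), identify opposite sides of the grid, and cut every block into six tetrahedra around its body-diagonal $v_x+v_y+v_z$, with face-diagonals $v_y+v_z$ ($yz$), $v_z+v_x$ ($zx$), $v_x+v_y$ ($xy$). This is a skew triangulation of a flat $T^3$; let $\ell^0$ be its family of edge-lengths. (All local sums below are taken in the universal cover.) For edge-lengths near $\ell^0$ the piecewise flat Ricci flow is the system $\frac{d|\ell|}{dt}=-Rc_\ell\,|\ell|$ over all edges $\ell$, where, with deficit angles $\epsilon_\ell=2\pi-\sum(\text{dihedral angles at }\ell)$, $$R_v=\frac1{V_v}\sum_{i}|\ell_i|\epsilon_i,\qquad K^\perp_\ell=\frac1{V_\ell}\Big(|\ell|\epsilon_\ell+\sum_i\tfrac12|\ell_i|\cos^2(\theta_i)\,\epsilon_i\Big),\qquad Rc_\ell=\tfrac14(R_{v_1}+R_{v_2})-K_\ell^\perp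 ,$$ $v_1,v_2$ being the ends of $\ell$. Here $V_v$ is the barycentric dual volume of $v$, and the sum in $R_v$ is over the edges at $v$; $V_\ell$ is the volume of the union of the dual cells of $v_1,v_2$ capped by the surfaces orthogonal to $\ell$ at $v_1$ and $v_2$; the sum in $K^\perp_\ell$ is over the edges $\ell_i$ that span a triangle of the triangulation with $\ell$ and make an acute angle $\theta_i$ with it. The coefficient matrix $A$ is the Jacobian of the right-hand side at $\ell^0$, and the flow is linearly unstable at $\ell^0$ if $\ell^0$ is stationary and $A$ has an eigenvalue with positive real part. \textbf{Theorem (linear instability of skew triangulations).} There are a real $3\times3$ matrix $M$, a real $\mu$ and $p=(p_{yz},p_{zx},p_{xy})\in\mathbb R^3$, not depending on $N_1,N_2,N_3,c$, such that, with an error of at most $0.0005$ in every entry, $$M\approx\begin{pmatrix}0.308&0.311&0.282\\0.410&0.415&0.376\\0.266&0.269&0.244\end{pmatrix},\qquad p\approx(0.532,\,0.710,\,0.461),\qquad 0.966\le\mu\le0.9665,$$ $Mp=\mu p$, every complex eigenvalue of $M$ has real part at most $\mu$, and for all $N_1,N_2,N_3\ge1$ and $c>0$: (a) the piecewise flat Ricci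 flow is linearly unstable at the flat skew triangulation $\ell^0$; (b) the coefficient matrix $A$ exists, and for every face-diagonal of type $s$ the sum of its coefficients with respect to all face-diagonals of type $t$ is $M_{st}/c^2$ ($s,t\in\{yz,zx,xy\}$); (c) $\mu/c^2$ is an eigenvalue of the block of $A$ that belongs to the face-diagonals, with the eigenvector that equals $p_{yz},p_{zx},p_{xy}$ on all $yz$-, $zx$-, $xy$-face-diagonals; extended by $0$ to the other edges, this vector $w$ is an eigenvector of the whole matrix $A$ for $\mu/c^2$; (d) consequently, for every $s\in\mathbb R$, $\delta(t)=s\,e^{\mu t/c^2}w$ solves the linearized equations $\dot\delta=A\delta$: perturbations of all face-diagonals grow exponentially at the rate $\mu/c^2\ge0.966/c^2$. -/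

import Mathlib

open scoped Matrix

noncomputable section

namespace SkewFlow

/-! ### The block triangulation of the three-torus

The universal cover of the grid is the triangulation of `ℝ³` with vertex set `ℤ³` (in block
coordinates) in which every unit block is cut into six tetrahedra around its body-diagonal. -/

/-- Vertices of the universal cover, in block coordinates. -/
abbrev Vtx : Type := Fin 3 → ℤ

/-- `q` is the upper end of an edge that starts at `p`: the difference is a nonzero `0/1` vector
(a block edge, a face-diagonal or a body-diagonal). -/
def Step (p q : Vtx) : Prop := p ≠ q ∧ ∀ i, q i = p i ∨ q i = p i + 1

instance (p q : Vtx) : Decidable (Step p q) := by unfold Step; infer_instance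

/-- `p` and `q` are joined by an edge. The simplices of the triangulation are the cliques of
this relation. -/
def Adj (p q : Vtx) : Prop := Step p q ∨ Step q p

instance (p q : Vtx) : Decidable (Adj p q) := by unfold Adj; infer_instance

/-- The 14 directions of the edges at a vertex. -/
def dirs : Finset Vtx :=
  (Fintype.piFinset fun _ : Fin 3 => ({-1, 0, 1} : Finset ℤ)).filter fun d => Adj 0 d

/-- The triangles that contain the edge from `p` to `p + d` are those with third vertex `p + e`,
for `e` in this set. -/
def linkDirs (d : Vtx) : Finset Vtx := dirs.filter fun e => Adj d e

/-- The tetrahedra that contain a vertex `v` are those with further vertices `v + e`, `v + f`,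
`v + g`, each listed once: the three further vertices are ordered upwards. -/
def starTets : Finset (Vtx × Vtx × Vtx) :=
  (dirs ×ˢ dirs ×ˢ dirs).filter fun t =>
    Step t.1 t.2.1 ∧ Step t.2.1 t.2.2 ∧ Step t.1 t.2.2

/-- The seven types of edges, as the sets of coordinates in which the two ends differ:
`{0}`, `{1}`, `{2}` are the `x`-, `y`-, `z`-edges, the two-element sets are the face-diagonals and
`{0, 1, 2}` is the body-diagonal. -/
abbrev EdgeType : Type := {S : Finset (Fin 3) // S.Nonempty}

/-- Edges of the `N 0 × N 1 × N 2` grid of blocks with opposite sides identified: the lower end in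
the periodic grid and the type. -/
abbrev Edge (N : Fin 3 → ℕ) : Type := ((i : Fin 3) → ZMod (N i)) × EdgeType

/-- The lower end of an edge, lifted to the universal cover. -/
def tail {N : Fin 3 → ℕ} (e : Edge N) : Vtx := fun i => ((e.1 i).val : ℤ)

/-- The upper end of an edge, lifted to the universal cover. -/
def head {N : Fin 3 → ℕ} (e : Edge N) : Vtx :=
  fun i => tail e i + if i ∈ e.2.1 then 1 else 0

/-- The face-diagonal types, in the order `yz`, `zx`, `xy`. -/
def faceDiag (i : Fin 3) : EdgeType :=
  ⟨Finset.univ.erase i, by revert i; decide⟩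

/-! ### The geometry determined by the edge-lengths -/

variable {N : Fin 3 → ℕ}

/-- Length of the edge between adjacent vertices of the universal cover (and `0` if `p = q`), for
the periodic edge-lengths `x`. -/
def len (x : Edge N → ℝ) (p q : Vtx) : ℝ :=
  if h : (Finset.univ.filter fun i => p i ≠ q i).Nonempty then
    x (fun i => ((min (p i) (q i) : ℤ) : ZMod (N i)), ⟨_, h⟩)
  else 0

/-- Cosine of the angle at `o` in the Euclidean triangle `o a b`. -/
def cosAngle (x : Edge N → ℝ) (o a b : Vtx) : ℝ :=
  (len x o a ^ 2 + len x o b ^ 2 - len x a b ^ 2) / (2 * len x o a * len x o b)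

/-- Dihedral angle at the edge `p q` of the Euclidean tetrahedron `p q r s`. -/
def dihedral (x : Edge N → ℝ) (p q r s : Vtx) : ℝ :=
  Real.arccos ((cosAngle x p r s - cosAngle x p q r * cosAngle x p q s) /
    (√(1 - cosAngle x p q r ^ 2) * √(1 - cosAngle x p q s ^ 2)))

/-- Volume of the Euclidean tetrahedron `p q r s`, from the Gram matrix of its edge vectors
at `p`. -/
def tetVol (x : Edge N → ℝ) (p q r s : Vtx) : ℝ :=
  √(Matrix.det (Matrix.of fun i j : Fin 3 =>
    (len x p (![q, r, s] i) ^ 2 + len x p (![q, r, s] j) ^ 2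
      - len x (![q, r, s] i) (![q, r, s] j) ^ 2) / 2)) / 6

/-- Deficit angle at the edge `p q`: `2π` minus the dihedral angles of all tetrahedra around it. -/
def deficit (x : Edge N → ℝ) (p q : Vtx) : ℝ :=
  2 * Real.pi - ∑ e ∈ linkDirs (q - p), ∑ f ∈ linkDirs (q - p),
    if Step e f then dihedral x p q (p + e) (p + f) else 0

/-- Barycentric dual volume of a vertex: a quarter of the volume of each tetrahedron at it. -/
def vertexVol (x : Edge N → ℝ) (v : Vtx) : ℝ :=
  (1 / 4) * ∑ t ∈ starTets, tetVol x v (v + t.1) (v + t.2.1) (v + t.2.2)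

/-! ### The intrinsic metric and the edge volumes

Points of the universal cover are written as points of `ℝ³`, affinely on every tetrahedron. -/

/-- Four vertices, ordered upwards, of a tetrahedron. -/
def IsTet (T : Fin 4 → Vtx) : Prop := ∀ i j, i < j → Step (T i) (T j)

/-- The point with barycentric coordinates `a` with respect to the vertices `T`. -/
def place (T : Fin 4 → Vtx) (a : Fin 4 → ℝ) : Fin 3 → ℝ := fun i => ∑ k, a k * (T k i : ℝ)

/-- Euclidean distance, in the tetrahedron `T`, of the points with barycentric coordinates
`a` and `b`. -/
def chord (x : Edge N → ℝ) (T : Fin 4 → Vtx) (a b : Fin 4 → ℝ) : ℝ :=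
  √(-(1 / 2) * ∑ i, ∑ j, len x (T i) (T j) ^ 2 * (a i - b i) * (a j - b j))

/-- `PolyLine x P Q s`: some polygonal line from `P` to `Q`, each piece of which lies in a single
tetrahedron, has length `s`. -/
inductive PolyLine (x : Edge N → ℝ) : (Fin 3 → ℝ) → (Fin 3 → ℝ) → ℝ → Prop
  | refl (P : Fin 3 → ℝ) : PolyLine x P P 0
  | cons (T : Fin 4 → Vtx) (a b : Fin 4 → ℝ) (Q : Fin 3 → ℝ) (s : ℝ) (hT : IsTet T)
      (ha : a ∈ stdSimplex ℝ (Fin 4)) (hb : b ∈ stdSimplex ℝ (Fin 4))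
      (h : PolyLine x (place T b) Q s) : PolyLine x (place T a) Q (chord x T a b + s)

/-- The intrinsic (path) metric of the piecewise flat manifold. -/
def pathDist (x : Edge N → ℝ) (P Q : Fin 3 → ℝ) : ℝ := sInf {s | PolyLine x P Q s}

/-- A vertex as a point. -/
def vpt (v : Vtx) : Fin 3 → ℝ := fun i => (v i : ℝ)

/-- The point with barycentric coordinates `1 - l 0 - l 1 - l 2, l 0, l 1, l 2` in the tetrahedron
with vertices `v, v + t.1, v + t.2.1, v + t.2.2`. -/
def starPoint (v : Vtx) (t : Vtx × Vtx × Vtx) (l : Fin 3 → ℝ) : Fin 3 → ℝ :=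
  place ![v, v + t.1, v + t.2.1, v + t.2.2] ![1 - ∑ i, l i, l 0, l 1, l 2]

/-- The part, in one tetrahedron at `v`, of the barycentric dual cell of `v` (the points whose
barycentric coordinate at `v` is the largest one) that lies between the two surfaces orthogonal to
the edge `v w` at its ends. The orthogonal surface at `v` consists of the points `P` with
`d(P, w)² = d(P, v)² + |vw|²`, and similarly at `w`. -/
def cappedCell (x : Edge N → ℝ) (v w : Vtx) (t : Vtx × Vtx × Vtx) : Set (Fin 3 → ℝ) :=
  {l | (∀ i, 0 ≤ l i ∧ l i ≤ 1 - ∑ j, l j) ∧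
    pathDist x (starPoint v t l) (vpt w) ^ 2
      ≤ pathDist x (starPoint v t l) (vpt v) ^ 2 + len x v w ^ 2 ∧
    pathDist x (starPoint v t l) (vpt v) ^ 2
      ≤ pathDist x (starPoint v t l) (vpt w) ^ 2 + len x v w ^ 2}

/-- Volume of the capped dual cell of `v`. In a tetrahedron of volume `V` the Euclidean volume is
`6 V` times Lebesgue measure in the coordinates `l`. -/
def cappedVol (x : Edge N → ℝ) (v w : Vtx) : ℝ :=
  ∑ t ∈ starTets, 6 * tetVol x v (v + t.1) (v + t.2.1) (v + t.2.2) *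
    MeasureTheory.volume.real (cappedCell x v w t)

/-- Edge volume: the union of the dual cells of both ends (which overlap in a null set), capped by
the surfaces orthogonal to the edge at its ends. -/
def edgeVol (x : Edge N → ℝ) (p q : Vtx) : ℝ := cappedVol x p q + cappedVol x q p

/-! ### Piecewise flat curvature and Ricci flow -/

/-- Scalar curvature at a vertex. -/
def scalarCurv (x : Edge N → ℝ) (v : Vtx) : ℝ :=
  (∑ d ∈ dirs, len x v (v + d) * deficit x v (v + d)) / vertexVol x v

/-- Sectional curvature orthogonal to the edge `p q`. Besides the edge itself, the sum runs over the
edges that span a triangle with it and that leave the common vertex on the inner side of the cap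
there, i.e. at an acute angle `θ`; edges at a right or obtuse angle contribute `0`. -/
def secCurv (x : Edge N → ℝ) (p q : Vtx) : ℝ :=
  (len x p q * deficit x p q + ∑ e ∈ linkDirs (q - p),
    (1 / 2 * len x p (p + e) * max 0 (cosAngle x p q (p + e)) ^ 2 * deficit x p (p + e)
      + 1 / 2 * len x q (p + e) * max 0 (cosAngle x q p (p + e)) ^ 2 * deficit x q (p + e)))
    / edgeVol x p q

/-- Ricci curvature along the edge `p q`. -/
def ricci (x : Edge N → ℝ) (p q : Vtx) : ℝ :=
  1 / 4 * (scalarCurv x p + scalarCurv x q) - secCurv x p q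

/-- The piecewise flat Ricci flow is the system `dx/dt = flow N x` for the edge-lengths `x`. -/
def flow (N : Fin 3 → ℕ) (x : Edge N → ℝ) : Edge N → ℝ :=
  fun e => -ricci x (tail e) (head e) * x e

/-! ### Flat skew triangulations -/

/-- The edge vectors `v_x, v_y, v_z` of the skew block of unit volume. -/
def skewBasis : Fin 3 → EuclideanSpace ℝ (Fin 3) :=
  ![!₂[1, -1 / 3, 0], !₂[0, 1, 0], !₂[-1 / 3, -2 / 9, 1]]

/-- Edge-lengths of the flat skew triangulation with blocks of volume `c ^ 3`. -/
def skewLengths (N : Fin 3 → ℕ) (c : ℝ) : Edge N → ℝ :=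
  fun e => c * ‖∑ i ∈ e.2.1, skewBasis i‖

/-! ### Linear stability -/

/-- `A` is the coefficient matrix of the linearization at `x₀` of the system `dx/dt = f x`. -/
def IsCoeffMatrix {ι : Type} [Fintype ι] [DecidableEq ι] (f : (ι → ℝ) → ι → ℝ) (x₀ : ι → ℝ)
    (A : Matrix ι ι ℝ) : Prop :=
  HasFDerivAt f (LinearMap.toContinuousLinearMap (Matrix.toLin' A)) x₀

/-- `ν` is a complex eigenvalue of the real matrix `A`. -/
def IsEigenvalue {ι : Type} [Fintype ι] [DecidableEq ι] (A : Matrix ι ι ℝ) (ν : ℂ) : Prop :=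
  Module.End.HasEigenvalue (Matrix.toLin' (A.map Complex.ofReal)) ν

/-- `x₀` is a stationary solution of `dx/dt = f x` at which the coefficient matrix of the
linearized equations has an eigenvalue with positive real part. -/
def LinearlyUnstable {ι : Type} [Fintype ι] [DecidableEq ι] (f : (ι → ℝ) → ι → ℝ)
    (x₀ : ι → ℝ) : Prop :=
  f x₀ = 0 ∧ ∃ A, IsCoeffMatrix f x₀ A ∧ ∃ ν : ℂ, IsEigenvalue A ν ∧ 0 < ν.re

/-- The block of `A` that belongs to the face-diagonals, indexed by grid position and type
(`0, 1, 2` for `yz`, `zx`, `xy`). -/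
def faceDiagBlock (A : Matrix (Edge N) (Edge N) ℝ) :
    Matrix (((i : Fin 3) → ZMod (N i)) × Fin 3) (((i : Fin 3) → ZMod (N i)) × Fin 3) ℝ :=
  A.submatrix (fun e => (e.1, faceDiag e.2)) (fun e => (e.1, faceDiag e.2))

/-- The perturbation that is `p 0`, `p 1`, `p 2` on all `yz`-, `zx`-, `xy`-face-diagonals and `0`
on all other edges. -/
def faceDiagVec (N : Fin 3 → ℕ) (p : Fin 3 → ℝ) : Edge N → ℝ :=
  fun e => ∑ i, if e.2 = faceDiag i then p i else 0

end SkewFlow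

end

/-! All deficit angles vanish at the flat triangulation, and the right-hand side of the flow is a
sum of products of a deficit with a coefficient (lengths, cosines, inverse volumes). Such a product
is differentiable at the flat point as soon as its coefficient is continuous there
(`hasFDerivAt_mul_of_eq_zero`). The coefficients thus enter `A` only through their flat values, and
the edge volumes, defined by an intrinsic metric, need only be shown continuous with flat value `c ^
3` (`continuousAt_edgeVol`, `edgeVol_skew`).

It remains to find the first variation of the deficits when all face-diagonals of one type change
alike. Periodic data consist of seven squared lengths. Those that come from a constant metric form a
six-dimensional space with no deficit, cut out by the parallelepiped identity: block edges plus
body-diagonal equals face-diagonals. So the deficits respond only to this alternating sum, in which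
the three face-diagonal types have equal weight. By Schläfli's formula the response matrix in the
lengths is symmetric, so the deficit at an edge of length `L` varies in proportion to `± L`, with
the minus sign on face-diagonals. The proof checks this by a finite exact computation
(`sum_linkPairs_var`, `hasDerivAt_deficit`).

Two consequences follow. The scalar curvature does not change to first order, by the same
alternating identity (`sum_dirs_sgn`). The sectional curvature changes by a combination of Gram
entries which, for this skew block, vanishes on block edges and the body-diagonal and is positive on
the face-diagonals (`secSum_typeDir`). Hence `A` preserves the space of type-wise constant
face-diagonal perturbations and acts on it as `1 / c ^ 2` times the rank-one matrix `faceResponse ⊗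
faceLen`. Its only nonzero eigenvalue is the trace `6340 / 6561`, with eigenvector proportional to
`faceResponse`. -/

open scoped Matrix

noncomputable section

namespace SkewFlow

/-! ### Lattice data of the star of a vertex, and flat edge-lengths in terms of them. -/

section

variable {N : Fin 3 → ℕ}

/-! ### Combinatorics of the star of a vertex -/

/-- `81` times the inner product of two lattice vectors of the skew block of unit volume. -/
def gram (a b : Vtx) : ℤ :=
  90 * (a 0 * b 0) + 81 * (a 1 * b 1) + 94 * (a 2 * b 2) - 27 * (a 0 * b 1 + a 1 * b 0)
    - 18 * (a 1 * b 2 + a 2 * b 1) - 21 * (a 0 * b 2 + a 2 * b 0)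

/-- The sign of an edge direction: `-1` for face-diagonals, `1` otherwise. -/
def sgn (d : Vtx) : ℤ := if (Finset.univ.filter fun i => d i ≠ 0).card = 2 then -1 else 1

/-- Indicator of the face-diagonals of type `j`. -/
def ind (j : Fin 3) (d : Vtx) : ℤ :=
  if (Finset.univ.filter fun i => d i ≠ 0) = Finset.univ.erase j then 1 else 0

/-- Derivative of `gram` (times `2 / 81`) when the squared length of the face-diagonals of type `j`
varies at unit rate. -/
def gramVar (j : Fin 3) (a b : Vtx) : ℤ := ind j a + ind j b - ind j (b - a)

/-- Consecutive pairs of vertices in the link of an edge. -/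
def linkPairs (d : Vtx) : Finset (Vtx × Vtx) :=
  (linkDirs d ×ˢ linkDirs d).filter fun e => Step e.1 e.2

/-- Gram determinant of `d, e` (times `81 ^ 2`). -/
def area (d e : Vtx) : ℤ := gram d d * gram e e - gram d e ^ 2

/-- The variation of `area` (times `2`). -/
def areaVar (j : Fin 3) (d e : Vtx) : ℤ :=
  gramVar j d d * gram e e + gram d d * gramVar j e e - 2 * gram d e * gramVar j d e

/-- Mixed Gram minor of `d, e` and `d, f`. -/
def minor (d e f : Vtx) : ℤ := gram e f * gram d d - gram d e * gram d f

/-- The variation of `minor` (times `2`). -/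
def minorVar (j : Fin 3) (d e f : Vtx) : ℤ :=
  gramVar j e f * gram d d + gram e f * gramVar j d d
    - gramVar j d e * gram d f - gram d e * gramVar j d f

/-- No neighbour of a vertex lies beyond the plane orthogonal to `d` at its far end. This makes the
far cap of a dual cell inactive. -/
theorem gram_le : ∀ d ∈ dirs, ∀ e ∈ dirs, gram d e ≤ gram d d := by decide +kernel

theorem gram_self_pos {d : Vtx} (hd : d ∈ dirs) : 0 < gram d d := by
  revert d
  decide +kernel

theorem area_pos {d e : Vtx} (hd : d ∈ dirs) (he : e ∈ linkDirs d) : 0 < area d e := by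
  have : ∀ d ∈ dirs, ∀ e ∈ linkDirs d, 0 < area d e := by decide +kernel
  exact this d hd e he

/-- Sylvester's identity: the left side is `gram d d` times the Gram determinant of `d, e.1, e.2`,
and the latter is `81 ^ 3` because the tetrahedra are unimodular in a block of volume one. The
square root in the derivative of a dihedral angle is therefore the same for all tetrahedra around an
edge, which reduces the variation of the deficit to rational arithmetic. -/
theorem linkPairs_det : ∀ d ∈ dirs, ∀ e ∈ linkPairs d,
    area d e.1 * area d e.2 - minor d e.1 e.2 ^ 2 = gram d d * 81 ^ 3 := by decide +kernel

/-- Modulo `d` the link is the centrally symmetric hexagon `a, a + b, b, -a, -a - b, -b` or the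
quadrilateral `a, b, -a, -b`. Unordered pairs are used because `Step` orders a pair upwards and not
cyclically. -/
theorem linkPairs_fan : ∀ d ∈ dirs,
    (∃ a ∈ linkDirs d, ∃ b ∈ linkDirs d, (linkPairs d).val.map (fun e => s(e.1, e.2)) =
      {s(a, a + b), s(a + b, b), s(b, d - a), s(d - a, d - a - b), s(d - a - b, d - b),
        s(d - b, a)}) ∨
    (∃ a ∈ linkDirs d, ∃ b ∈ linkDirs d, (linkPairs d).val.map (fun e => s(e.1, e.2)) =
      {s(a, b), s(b, d - a), s(d - a, d - b), s(d - b, a)}) := by decide +kernel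

/-- The summands are the numerators of the derivatives of the dihedral angles around the edge. The
total does not depend on `j`, and this is why the growth matrix has rank one. -/
theorem sum_linkPairs_var : ∀ d ∈ dirs, ∀ j : Fin 3,
    ∑ e ∈ linkPairs d, ((minorVar j d e.1 e.2 : ℚ) - minor d e.1 e.2 / 2 *
      (areaVar j d e.1 / area d e.1 + areaVar j d e.2 / area d e.2)) =
      2 * sgn d * gram d d := by decide +kernel

/-- The identity `|a|² + |b|² + |c|² + |a+b+c|² = |a+b|² + |b+c|² + |c+a|²`, with every edge type
counted twice. -/
theorem sum_dirs_sgn : ∑ d ∈ dirs, sgn d * gram d d = 0 := by decide +kernel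

/-- `2 * gram d d` times the curvature `secCurv` of an edge in direction `d`, in suitable units. -/
def secSum (d : Vtx) : ℤ :=
  2 * sgn d * gram d d ^ 2 + ∑ e ∈ linkDirs d,
    (sgn e * max 0 (gram d e) ^ 2 + sgn (e - d) * max 0 (-gram d (e - d)) ^ 2)

/-- The direction of the edges of a type. -/
def typeDir (S : EdgeType) : Vtx := fun i => if i ∈ S.1 then 1 else 0

/-- The zeros keep block edges and body-diagonals fixed to first order, so that an eigenvector on
the face-diagonals extends by zero to the whole matrix. They depend on the chosen shape of the
block. -/
theorem secSum_typeDir : ∀ S : EdgeType, secSum (typeDir S) =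
    if S = faceDiag 0 then 2018 else if S = faceDiag 1 then 2720 else
      if S = faceDiag 2 then 1602 else 0 := by
  decide +kernel

theorem typeDir_mem_dirs : ∀ S : EdgeType, typeDir S ∈ dirs := by decide +kernel

theorem gram_faceDiag : ∀ i : Fin 3,
    gram (typeDir (faceDiag i)) (typeDir (faceDiag i)) = ![139, 142, 117] i := by decide +kernel

theorem head_eq {N : Fin 3 → ℕ} (e : Edge N) : head e = tail e + typeDir e.2 := rfl

theorem mem_linkDirs {d e : Vtx} : e ∈ linkDirs d ↔ e ∈ dirs ∧ Adj d e := by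
  simp [linkDirs]

theorem mem_linkPairs {d : Vtx} {e : Vtx × Vtx} :
    e ∈ linkPairs d ↔ (e.1 ∈ linkDirs d ∧ e.2 ∈ linkDirs d) ∧ Step e.1 e.2 := by
  simp [linkPairs]

theorem adj_zero_of_mem_dirs {d : Vtx} (h : d ∈ dirs) : Adj 0 d := by
  simp only [dirs, Finset.mem_filter] at h
  exact h.2

theorem mem_dirs_of_adj {d : Vtx} (h : Adj 0 d) : d ∈ dirs := by
  simp only [dirs, Finset.mem_filter, Fintype.mem_piFinset, Finset.mem_insert,
    Finset.mem_singleton]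
  refine ⟨fun i => ?_, h⟩
  rcases h with h | h <;> have := h.2 i <;> simp only [Pi.zero_apply] at this <;> omega

theorem step_add_left (p : Vtx) {q r : Vtx} : Step (p + q) (p + r) ↔ Step q r := by
  simp [Step, add_assoc]

theorem adj_add_left (p : Vtx) {q r : Vtx} : Adj (p + q) (p + r) ↔ Adj q r := by
  simp [Adj, step_add_left]

theorem adj_iff_sub_mem {p q : Vtx} : Adj p q ↔ q - p ∈ dirs := by
  constructor
  · intro h
    exact mem_dirs_of_adj (by rw [← adj_add_left p]; simpa using h)
  · intro h
    have := (adj_add_left p).2 (adj_zero_of_mem_dirs h)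
    simpa using this

theorem Adj.symm {p q : Vtx} (h : Adj p q) : Adj q p := Or.symm h

theorem Adj.ne {p q : Vtx} (h : Adj p q) : p ≠ q := by
  rcases h with h | h
  · exact h.1
  · exact h.1.symm

theorem neg_mem_dirs {d : Vtx} (h : d ∈ dirs) : -d ∈ dirs := by
  have : Adj d 0 := (adj_zero_of_mem_dirs h).symm
  simpa using adj_iff_sub_mem.1 this

theorem gram_neg (a b : Vtx) : gram (-a) (-b) = gram a b := by
  simp [gram]

theorem ind_zero : ∀ j, ind j 0 = 0 := by decide +kernel

/-! ### Edge-lengths -/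

/-- The affine map from block coordinates to the skew block of unit volume. -/
def emb : (Fin 3 → ℝ) →ₗ[ℝ] EuclideanSpace ℝ (Fin 3) :=
  Fintype.linearCombination ℝ skewBasis

theorem emb_apply (P : Fin 3 → ℝ) : emb P = ∑ i, P i • skewBasis i := rfl

theorem vpt_add (a b : Vtx) : vpt (a + b) = vpt a + vpt b := by
  ext i; simp [vpt]

theorem vpt_sub (a b : Vtx) : vpt (a - b) = vpt a - vpt b := by
  ext i; simp [vpt]

theorem vpt_neg (a : Vtx) : vpt (-a) = -vpt a := by
  ext i; simp [vpt]

theorem inner_emb (P Q : Fin 3 → ℝ) : inner ℝ (emb P) (emb Q) =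
    (90 * (P 0 * Q 0) + 81 * (P 1 * Q 1) + 94 * (P 2 * Q 2) - 27 * (P 0 * Q 1 + P 1 * Q 0)
    - 18 * (P 1 * Q 2 + P 2 * Q 1) - 21 * (P 0 * Q 2 + P 2 * Q 0)) / 81 := by
  simp [emb_apply, PiLp.inner_apply, Fin.sum_univ_three, skewBasis]
  ring

theorem inner_emb_vpt (a b : Vtx) : inner ℝ (emb (vpt a)) (emb (vpt b)) = (gram a b : ℝ) / 81 := by
  rw [inner_emb]
  simp [gram, vpt]

theorem len_comm (x : Edge N → ℝ) (p q : Vtx) : len x p q = len x q p := by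
  unfold len
  simp only [min_comm, ne_comm]

/-- The lengths `φ S` on all edges of type `S`. -/
def invariant (N : Fin 3 → ℕ) (φ : EdgeType → ℝ) : Edge N → ℝ := fun e => φ e.2

theorem len_invariant (φ : EdgeType → ℝ) (p q : Vtx) : len (invariant N φ) p q =
    if h : (Finset.univ.filter fun i => (q - p) i ≠ 0).Nonempty then φ ⟨_, h⟩ else 0 := by
  have : (fun i => p i ≠ q i) = fun i => (q - p) i ≠ 0 := by
    ext i
    simp [sub_eq_zero, eq_comm]
  unfold len invariant
  simp only [this]

theorem len_self (x : Edge N → ℝ) (p : Vtx) : len x p p = 0 := by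
  simp [len]

theorem len_of_ne (x : Edge N → ℝ) {p q : Vtx} (h : p ≠ q) : ∃ e : Edge N, len x p q = x e := by
  have : (Finset.univ.filter fun i => p i ≠ q i).Nonempty := by
    obtain ⟨i, hi⟩ := Function.ne_iff.1 h
    exact ⟨i, by simpa using hi⟩
  exact ⟨_, by rw [len, dif_pos this]⟩

theorem emb_vpt_of_step {d : Vtx} (h : Step 0 d) :
    emb (vpt d) = ∑ i ∈ Finset.univ.filter (fun i => d i ≠ 0), skewBasis i := by
  rw [emb_apply, Finset.sum_filter]
  refine Finset.sum_congr rfl fun i _ => ?_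
  rcases h.2 i with h | h <;> simp [vpt, h]

theorem skewLengths_eq (c : ℝ) : skewLengths N c =
    invariant N fun S => c * ‖∑ i ∈ S.1, skewBasis i‖ := rfl

theorem len_skew {c : ℝ} {p q : Vtx} (h : Adj p q) :
    len (skewLengths N c) p q = c * ‖emb (vpt (q - p))‖ := by
  have key : ∀ p q : Vtx, Step p q →
      len (skewLengths N c) p q = c * ‖emb (vpt (q - p))‖ := by
    intro p q h
    have h0 : Step 0 (q - p) := by
      rw [← step_add_left p]; simpa using h
    rw [skewLengths_eq, len_invariant, emb_vpt_of_step h0]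
    have : (Finset.univ.filter fun i => (q - p) i ≠ 0).Nonempty := by
      obtain ⟨i, hi⟩ := Function.ne_iff.1 h0.1
      exact ⟨i, by simpa using Ne.symm hi⟩
    rw [dif_pos this]
  rcases h with h | h
  · exact key p q h
  · rw [len_comm, key q p h, ← neg_sub q p, vpt_neg, map_neg, norm_neg]

theorem len_skew_sq {c : ℝ} {p q : Vtx} (h : Adj p q) :
    len (skewLengths N c) p q ^ 2 = c ^ 2 * (gram (q - p) (q - p) / 81) := by
  rw [len_skew h, mul_pow, ← real_inner_self_eq_norm_sq, inner_emb_vpt]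

theorem len_skew_pos {c : ℝ} (hc : 0 < c) {p q : Vtx} (h : Adj p q) :
    0 < len (skewLengths N c) p q := by
  have h1 := gram_self_pos (adj_iff_sub_mem.1 h)
  have h2 := len_skew_sq (N := N) (c := c) h
  have h3 : 0 ≤ len (skewLengths N c) p q := by
    rw [len_skew h]; positivity
  have h4 : 0 < len (skewLengths N c) p q ^ 2 := by
    rw [h2]; have : (0 : ℝ) < gram (q - p) (q - p) := by exact_mod_cast h1
    positivity
  exact lt_of_le_of_ne h3 fun h => by simp [← h] at h4

theorem skewLengths_pos {c : ℝ} (hc : 0 < c) (e : Edge N) : 0 < skewLengths N c e := by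
  have h := len_skew_pos (N := N) hc (adj_zero_of_mem_dirs (typeDir_mem_dirs e.2))
  rw [skewLengths_eq, len_invariant] at h
  have hs : ∀ S : EdgeType, (Finset.univ.filter fun i => (typeDir S - 0) i ≠ 0) = S.1 := by
    decide +kernel
  rw [dif_pos (by rw [hs]; exact e.2.2)] at h
  simp only [hs] at h
  exact h

theorem skewLengths_eq_sqrt {c : ℝ} (e : Edge N) :
    skewLengths N c e = c * √(gram (typeDir e.2) (typeDir e.2) / 81) := by
  have hs : ∀ S : EdgeType, Step 0 (typeDir S) := by decide +kernel
  have hs' : ∀ S : EdgeType, (Finset.univ.filter fun i => (typeDir S) i ≠ 0) = S.1 := by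
    decide +kernel
  have h := emb_vpt_of_step (hs e.2)
  rw [hs'] at h
  rw [← inner_emb_vpt, real_inner_self_eq_norm_sq, Real.sqrt_sq (norm_nonneg _), h]
  rfl

end

/-! ### Dihedral angles as functions of squared lengths, and angle sums of symmetric fans. -/

section

variable {N : Fin 3 → ℕ}

/-! ### Dihedral angles -/

/-- Gram determinant `⟨u, u⟩⟨r, r⟩ - ⟨u, r⟩²` of two edge vectors with squared lengths `a`, `b` and
squared distance `d` of the end points. -/
def sqArea (a b d : ℝ) : ℝ := a * b - ((a + b - d) / 2) ^ 2

/-- The mixed Gram minor `⟨r, s⟩⟨u, u⟩ - ⟨u, r⟩⟨u, s⟩` of edge vectors `u, r, s` with squared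
lengths `a, b, c`, where `d, e, f` are the squared distances of the end points of `u, r`; `u, s`;
`r, s`. -/
def sqMinor (a b c d e f : ℝ) : ℝ := (b + c - f) / 2 * a - (a + b - d) / 2 * ((a + c - e) / 2)

theorem arccos_arg_eq {u r s d e f : ℝ} (hu : 0 < u) (hr : 0 < r) (hs : 0 < s) :
    ((r ^ 2 + s ^ 2 - f ^ 2) / (2 * r * s) - (u ^ 2 + r ^ 2 - d ^ 2) / (2 * u * r) *
      ((u ^ 2 + s ^ 2 - e ^ 2) / (2 * u * s))) /
      (√(1 - ((u ^ 2 + r ^ 2 - d ^ 2) / (2 * u * r)) ^ 2) *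
        √(1 - ((u ^ 2 + s ^ 2 - e ^ 2) / (2 * u * s)) ^ 2)) =
    sqMinor (u ^ 2) (r ^ 2) (s ^ 2) (d ^ 2) (e ^ 2) (f ^ 2) /
      (√(sqArea (u ^ 2) (r ^ 2) (d ^ 2)) * √(sqArea (u ^ 2) (s ^ 2) (e ^ 2))) := by
  have h : ∀ r d : ℝ, 0 < r → √(1 - ((u ^ 2 + r ^ 2 - d ^ 2) / (2 * u * r)) ^ 2) =
      √(sqArea (u ^ 2) (r ^ 2) (d ^ 2)) / (u * r) := by
    intro r d hr
    rw [show 1 - ((u ^ 2 + r ^ 2 - d ^ 2) / (2 * u * r)) ^ 2 =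
      sqArea (u ^ 2) (r ^ 2) (d ^ 2) / (u * r) ^ 2 by unfold sqArea; field_simp,
      Real.sqrt_div' _ (by positivity), Real.sqrt_sq (by positivity)]
  rw [h r d hr, h s e hs, sqMinor]
  generalize √(sqArea (u ^ 2) (r ^ 2) (d ^ 2)) = A
  generalize √(sqArea (u ^ 2) (s ^ 2) (e ^ 2)) = B
  rw [div_mul_div_comm A, div_div_eq_mul_div]
  congr 1
  field_simp

/-- The dihedral angle in terms of the squared lengths. -/
theorem dihedral_eq (x : Edge N → ℝ) {p q r s : Vtx} (hq : 0 < len x p q) (hr : 0 < len x p r)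
    (hs : 0 < len x p s) : dihedral x p q r s =
    Real.arccos (sqMinor (len x p q ^ 2) (len x p r ^ 2) (len x p s ^ 2) (len x q r ^ 2)
      (len x q s ^ 2) (len x r s ^ 2) / (√(sqArea (len x p q ^ 2) (len x p r ^ 2) (len x q r ^ 2)) *
        √(sqArea (len x p q ^ 2) (len x p s ^ 2) (len x q s ^ 2)))) := by
  unfold dihedral cosAngle
  rw [arccos_arg_eq hq hr hs]

theorem abs_minor_div_lt_one {X P Q : ℝ} (hP : 0 < P) (hQ : 0 < Q) (h : 0 < P * Q - X ^ 2) :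
    |X / (√P * √Q)| < 1 := by
  rw [← Real.sqrt_mul hP.le, abs_div, abs_of_nonneg (Real.sqrt_nonneg _),
    div_lt_one (Real.sqrt_pos.2 (by positivity))]
  exact (Real.lt_sqrt (abs_nonneg _)).2 (by rw [sq_abs]; linarith)

/-- In this form the only root left is that of `P * Q - X ^ 2`, which `linkPairs_det` evaluates. -/
theorem hasDerivAt_arccos_minor {X P Q : ℝ → ℝ} {X' P' Q' t : ℝ} (hX : HasDerivAt X X' t)
    (hP : HasDerivAt P P' t) (hQ : HasDerivAt Q Q' t) (P0 : 0 < P t) (Q0 : 0 < Q t)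
    (h : 0 < P t * Q t - X t ^ 2) :
    HasDerivAt (fun τ => Real.arccos (X τ / (√(P τ) * √(Q τ))))
      (-(X' - X t / 2 * (P' / P t + Q' / Q t)) / √(P t * Q t - X t ^ 2)) t := by
  have habs := abs_lt.1 (abs_minor_div_lt_one P0 Q0 h)
  have h1 := (Real.hasDerivAt_arccos habs.1.ne' habs.2.ne).comp t
    (hX.div ((hP.sqrt P0.ne').mul (hQ.sqrt Q0.ne'))
      (mul_pos (Real.sqrt_pos.2 P0) (Real.sqrt_pos.2 Q0)).ne')
  refine h1.congr_deriv ?_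
  have hp := Real.sqrt_pos.2 P0
  have hq := Real.sqrt_pos.2 Q0
  have hp2 := Real.sq_sqrt P0.le
  have hq2 := Real.sq_sqrt Q0.le
  have hr := Real.sqrt_pos.2 h
  have e1 : √(1 - (X t / (√(P t) * √(Q t))) ^ 2) =
      √(P t * Q t - X t ^ 2) / (√(P t) * √(Q t)) := by
    rw [show 1 - (X t / (√(P t) * √(Q t))) ^ 2 =
      (P t * Q t - X t ^ 2) / (√(P t) * √(Q t)) ^ 2 by
        rw [div_pow, mul_pow, hp2, hq2]; field_simp,
      Real.sqrt_div' _ (by positivity), Real.sqrt_sq (by positivity)]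
  simp only [Pi.mul_apply]
  rw [e1]
  generalize √(P t * Q t - X t ^ 2) = R at *
  rw [← hp2, ← hq2]
  simp only [Real.sqrt_sq hp.le, Real.sqrt_sq hq.le]
  generalize √(P t) = a at *
  generalize √(Q t) = b at *
  field_simp

theorem differentiableAt_arccos_minor {E : Type*} [NormedAddCommGroup E] [NormedSpace ℝ E]
    {X P Q : E → ℝ} {t : E} (hX : DifferentiableAt ℝ X t) (hP : DifferentiableAt ℝ P t)
    (hQ : DifferentiableAt ℝ Q t) (P0 : 0 < P t) (Q0 : 0 < Q t)
    (h : 0 < P t * Q t - X t ^ 2) :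
    DifferentiableAt ℝ (fun τ => Real.arccos (X τ / (√(P τ) * √(Q τ)))) t := by
  have habs := abs_lt.1 (abs_minor_div_lt_one P0 Q0 h)
  have h1 : DifferentiableAt ℝ (fun τ => X τ / (√(P τ) * √(Q τ))) t := by
    have hp := hP.sqrt P0.ne'
    have hq := hQ.sqrt Q0.ne'
    have hpq := (mul_pos (Real.sqrt_pos.2 P0) (Real.sqrt_pos.2 Q0)).ne'
    fun_prop (disch := assumption)
  exact DifferentiableAt.fun_comp' (g := Real.arccos) t
    (Real.differentiableAt_arccos.2 ⟨habs.1.ne', habs.2.ne⟩) h1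

/-! ### Flat edges -/

/-- Orthogonal projection along `u`. -/
def perp {E : Type*} [NormedAddCommGroup E] [InnerProductSpace ℝ E] (u : E) : E →ₗ[ℝ] E :=
  LinearMap.id - (LinearMap.toSpanSingleton ℝ E u).comp
    ((inner ℝ u u)⁻¹ • (innerₗ E u))

section
variable {E : Type*} [NormedAddCommGroup E] [InnerProductSpace ℝ E]

theorem perp_apply (u r : E) : perp u r = r - ((inner ℝ u u)⁻¹ * inner ℝ u r) • u := by
  simp [perp]

theorem perp_self (u : E) : perp u u = 0 := by
  rw [perp_apply]
  by_cases h : u = 0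
  · simp [h]
  · rw [inv_mul_cancel₀ (by simpa using h), one_smul, sub_self]

theorem inner_perp {u : E} (hu : u ≠ 0) (r s : E) : inner ℝ (perp u r) (perp u s) =
    (inner ℝ r s * inner ℝ u u - inner ℝ u r * inner ℝ u s) / inner ℝ u u := by
  have : inner ℝ u u ≠ 0 := by simpa using hu
  simp only [perp_apply, inner_sub_left, inner_sub_right, inner_smul_left, inner_smul_right,
    real_inner_comm u r]
  simp
  field_simp
  ring

/-- The right side is the dihedral angle at `u` as it comes out of the lengths; flatness thus
becomes a statement about angles between projections along the edge. -/
theorem angle_perp {u : E} (hu : u ≠ 0) (r s : E) :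
    InnerProductGeometry.angle (perp u r) (perp u s) =
      Real.arccos (sqMinor (‖u‖ ^ 2) (‖r‖ ^ 2) (‖s‖ ^ 2) (‖r - u‖ ^ 2) (‖s - u‖ ^ 2) (‖s - r‖ ^ 2) /
        (√(sqArea (‖u‖ ^ 2) (‖r‖ ^ 2) (‖r - u‖ ^ 2)) *
          √(sqArea (‖u‖ ^ 2) (‖s‖ ^ 2) (‖s - u‖ ^ 2)))) := by
  have hn : ∀ r, ‖perp u r‖ = √(sqArea (‖u‖ ^ 2) (‖r‖ ^ 2) (‖r - u‖ ^ 2)) / ‖u‖ := by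
    intro r
    rw [← Real.sqrt_sq (norm_nonneg (perp u r)), ← real_inner_self_eq_norm_sq, inner_perp hu,
      show sqArea (‖u‖ ^ 2) (‖r‖ ^ 2) (‖r - u‖ ^ 2) =
        inner ℝ r r * inner ℝ u u - inner ℝ u r * inner ℝ u r by
          rw [sqArea, norm_sub_sq_real, real_inner_self_eq_norm_sq, real_inner_self_eq_norm_sq,
            real_inner_comm]; ring,
      Real.sqrt_div' _ real_inner_self_nonneg, real_inner_self_eq_norm_sq u,
      Real.sqrt_sq (norm_nonneg u)]
  rw [InnerProductGeometry.angle, hn, hn, inner_perp hu]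
  have hu' : 0 < ‖u‖ := norm_pos_iff.2 hu
  congr 1
  rw [show sqMinor (‖u‖ ^ 2) (‖r‖ ^ 2) (‖s‖ ^ 2) (‖r - u‖ ^ 2) (‖s - u‖ ^ 2) (‖s - r‖ ^ 2) =
      inner ℝ r s * inner ℝ u u - inner ℝ u r * inner ℝ u s by
        rw [sqMinor, norm_sub_sq_real, norm_sub_sq_real, norm_sub_sq_real,
          real_inner_self_eq_norm_sq, real_inner_comm u r, real_inner_comm u s,
          real_inner_comm r s]; ring, real_inner_self_eq_norm_sq u, div_mul_div_comm, ← pow_two,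
      div_div_div_cancel_right₀ (by positivity)]

open InnerProductGeometry in
-- Three of the six angles are the angles of the triangle `0, a, -b`; the other three are their
-- images under the central symmetry.
theorem angle_fan_six {a b : E} (hb : b ≠ 0) :
    angle a (a + b) + angle (a + b) b + angle b (-a) + angle (-a) (-(a + b))
      + angle (-(a + b)) (-b) + angle (-b) a = 2 * Real.pi := by
  have h := angle_add_angle_sub_add_angle_sub_eq_pi a (neg_ne_zero.2 hb)
  have e1 : angle (-b) (-b - a) = angle (a + b) b := by
    rw [show -b - a = -(a + b) by abel, angle_neg_neg, angle_comm]
  rw [sub_neg_eq_add, e1] at h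
  rw [angle_neg_neg, angle_neg_neg, ← angle_neg_neg b (-a), neg_neg, angle_comm (-b) a]
  linarith

open InnerProductGeometry in
theorem angle_fan_four {a b : E} :
    angle a b + angle b (-a) + angle (-a) (-b) + angle (-b) a = 2 * Real.pi := by
  rw [angle_neg_neg, angle_neg_right, angle_neg_left, angle_comm b a]
  ring

end

end

/-! ### Flatness and first variation of the deficit angles. -/

section

variable {N : Fin 3 → ℕ}

/-! ### The deficit angles near the flat skew triangulation -/

theorem deficit_eq (x : Edge N → ℝ) (p d : Vtx) : deficit x p (p + d) =
    2 * Real.pi - ∑ e ∈ linkPairs d, dihedral x p (p + d) (p + e.1) (p + e.2) := by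
  rw [deficit, add_sub_cancel_left, linkPairs, Finset.sum_filter, Finset.sum_product]

theorem adj_add {p d : Vtx} (h : d ∈ dirs) : Adj p (p + d) :=
  adj_iff_sub_mem.2 (by simpa using h)

theorem gram_sub (a b : Vtx) : gram (b - a) (b - a) = gram a a + gram b b - 2 * gram a b := by
  simp only [gram, Pi.sub_apply]; ring

theorem sqArea_gram (k : ℝ) (d e : Vtx) :
    sqArea (k * (gram d d / 81)) (k * (gram e e / 81)) (k * (gram (e - d) (e - d) / 81)) =
      k ^ 2 / 81 ^ 2 * area d e := by
  rw [gram_sub]; simp only [sqArea, area]; push_cast; ring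

theorem sqMinor_gram (k : ℝ) (d e f : Vtx) :
    sqMinor (k * (gram d d / 81)) (k * (gram e e / 81)) (k * (gram f f / 81))
      (k * (gram (e - d) (e - d) / 81)) (k * (gram (f - d) (f - d) / 81))
      (k * (gram (f - e) (f - e) / 81)) =
      k ^ 2 / 81 ^ 2 * minor d e f := by
  rw [gram_sub, gram_sub, gram_sub]; simp only [sqMinor, minor]; push_cast; ring

/-- The vertices `0, d, e, f` form a tetrahedron. -/
structure IsLinkTriple (d e f : Vtx) : Prop where
  adj_d : d ∈ dirs
  adj_e : e ∈ dirs
  adj_f : f ∈ dirs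
  adj_de : Adj d e
  adj_df : Adj d f
  adj_ef : Adj e f

theorem isLinkTriple {d : Vtx} (hd : d ∈ dirs) {e : Vtx × Vtx} (he : e ∈ linkPairs d) :
    IsLinkTriple d e.1 e.2 := by
  obtain ⟨⟨h1, h2⟩, h3⟩ := mem_linkPairs.1 he
  obtain ⟨h1, h1'⟩ := mem_linkDirs.1 h1
  obtain ⟨h2, h2'⟩ := mem_linkDirs.1 h2
  exact ⟨hd, h1, h2, h1', h2', Or.inl h3⟩

/-- The embedded edge vectors of the blocks of volume `c ^ 3`. -/
def edgeVec (c : ℝ) (a : Vtx) : EuclideanSpace ℝ (Fin 3) := c • emb (vpt a)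

theorem edgeVec_add (c : ℝ) (a b : Vtx) : edgeVec c (a + b) = edgeVec c a + edgeVec c b := by
  simp [edgeVec, vpt_add]

theorem edgeVec_sub (c : ℝ) (a b : Vtx) : edgeVec c (a - b) = edgeVec c a - edgeVec c b := by
  simp [edgeVec, vpt_sub, smul_sub]

theorem inner_edgeVec (c : ℝ) (a b : Vtx) :
    inner ℝ (edgeVec c a) (edgeVec c b) = c ^ 2 * (gram a b / 81) := by
  rw [edgeVec, edgeVec, inner_smul_left, inner_smul_right, inner_emb_vpt]
  simp; ring

theorem norm_edgeVec_sq (c : ℝ) (a : Vtx) : ‖edgeVec c a‖ ^ 2 = c ^ 2 * (gram a a / 81) := by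
  rw [← real_inner_self_eq_norm_sq, inner_edgeVec]

theorem len_skew_add_sq {c : ℝ} {p a b : Vtx} (h : Adj a b) :
    len (skewLengths N c) (p + a) (p + b) ^ 2 = c ^ 2 * (gram (b - a) (b - a) / 81) := by
  rw [len_skew_sq ((adj_add_left p).2 h)]; simp

theorem len_skew_base_sq {c : ℝ} {p b : Vtx} (h : b ∈ dirs) :
    len (skewLengths N c) p (p + b) ^ 2 = c ^ 2 * (gram b b / 81) := by
  rw [len_skew_sq (adj_add h)]; simp

theorem dihedral_skew {c : ℝ} (hc : 0 < c) {d e f : Vtx} (h : IsLinkTriple d e f) (p : Vtx) :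
    dihedral (skewLengths N c) p (p + d) (p + e) (p + f) = InnerProductGeometry.angle
      (perp (edgeVec c d) (edgeVec c e)) (perp (edgeVec c d) (edgeVec c f)) := by
  have hd : edgeVec c d ≠ 0 := by
    intro h0
    have h1 := norm_edgeVec_sq c d
    have h2 : (0 : ℝ) < gram d d := by exact_mod_cast gram_self_pos h.adj_d
    have : 0 < c ^ 2 * (gram d d / 81 : ℝ) := by positivity
    rw [h0] at h1
    simp at h1
    rcases h1 with h1 | h1
    · exact hc.ne' h1
    · rw [h1] at h2; simp at h2
  rw [dihedral_eq _ (len_skew_pos hc (adj_add h.adj_d)) (len_skew_pos hc (adj_add h.adj_e))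
    (len_skew_pos hc (adj_add h.adj_f)), angle_perp hd]
  simp only [len_skew_base_sq h.adj_d, len_skew_base_sq h.adj_e, len_skew_base_sq h.adj_f,
    len_skew_add_sq h.adj_de, len_skew_add_sq h.adj_df, len_skew_add_sq h.adj_ef,
    ← edgeVec_sub, norm_edgeVec_sq]

theorem perp_edgeVec_ne_zero {c : ℝ} (hc : 0 < c) {d e : Vtx} (hd : d ∈ dirs)
    (he : e ∈ linkDirs d) : perp (edgeVec c d) (edgeVec c e) ≠ 0 := by
  intro h
  have h1 : (0 : ℝ) < area d e := by exact_mod_cast area_pos hd he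
  have h2 : (0 : ℝ) < gram d d := by exact_mod_cast gram_self_pos hd
  by_cases h0 : edgeVec c d = 0
  · have := norm_edgeVec_sq c d
    rw [h0] at this
    have h3 : 0 < c ^ 2 * (gram d d / 81 : ℝ) := by positivity
    rw [← this] at h3
    simp at h3
  have h3 := inner_perp h0 (edgeVec c e) (edgeVec c e)
  rw [h, inner_zero_left, eq_comm, div_eq_zero_iff] at h3
  simp only [inner_edgeVec] at h3
  have h4 : c ^ 2 * (gram e e / 81 : ℝ) * (c ^ 2 * (gram d d / 81)) -
    c ^ 2 * (gram d e / 81) * (c ^ 2 * (gram d e / 81)) = c ^ 4 / 81 ^ 2 * area d e := by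
      simp only [area]; push_cast; ring
  rw [h4] at h3
  have : 0 < c ^ 4 / 81 ^ 2 * (area d e : ℝ) := by positivity
  have : 0 < c ^ 2 * (gram d d / 81 : ℝ) := by positivity
  rcases h3 with h3 | h3 <;> linarith

theorem deficit_skew {c : ℝ} (hc : 0 < c) {d : Vtx} (hd : d ∈ dirs) (p : Vtx) :
    deficit (skewLengths N c) p (p + d) = 0 := by
  rw [deficit_eq, Finset.sum_congr rfl fun e he => dihedral_skew hc (isLinkTriple hd he) p]
  set v : Vtx → EuclideanSpace ℝ (Fin 3) := fun a => perp (edgeVec c d) (edgeVec c a) with hv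
  have hadd : ∀ a b, v (a + b) = v a + v b := fun a b => by simp [hv, edgeVec_add]
  have hsub : ∀ a, v (d - a) = -v a := fun a => by
    simp only [hv, edgeVec_sub, map_sub, perp_self, zero_sub]
  have hsub2 : ∀ a b, v (d - a - b) = -(v a + v b) := fun a b => by
    rw [sub_sub, hsub, hadd]
  -- The angle is symmetric, so it descends to unordered pairs, the form in which the fan is listed.
  let F : Sym2 Vtx → ℝ := Sym2.lift ⟨fun a b => InnerProductGeometry.angle (v a) (v b),
    fun a b => InnerProductGeometry.angle_comm _ _⟩
  have hF : ∀ a b, F s(a, b) = InnerProductGeometry.angle (v a) (v b) := fun a b => rfl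
  have hsum : ∑ e ∈ linkPairs d, InnerProductGeometry.angle (v e.1) (v e.2) =
      (((linkPairs d).val.map fun e => s(e.1, e.2)).map F).sum := by
    rw [Multiset.map_map]; rfl
  change 2 * Real.pi - ∑ e ∈ linkPairs d, InnerProductGeometry.angle (v e.1) (v e.2) = 0
  rw [hsum]
  rcases linkPairs_fan d hd with ⟨a, ha, b, hb, h⟩ | ⟨a, ha, b, hb, h⟩
  · have key := angle_fan_six (a := v a) (perp_edgeVec_ne_zero hc hd hb)
    change InnerProductGeometry.angle (v a) (v a + v b) +
      InnerProductGeometry.angle (v a + v b) (v b) + InnerProductGeometry.angle (v b) (-v a) +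
      InnerProductGeometry.angle (-v a) (-(v a + v b)) +
      InnerProductGeometry.angle (-(v a + v b)) (-v b) +
      InnerProductGeometry.angle (-v b) (v a) = _ at key
    rw [h]
    simp [hF, hadd, hsub, hsub2] at key ⊢
    linarith
  · have key := angle_fan_four (a := v a) (b := v b)
    rw [h]
    simp [hF, hsub] at key ⊢
    linarith

theorem eventually_pos {c : ℝ} (hc : 0 < c) [∀ i, NeZero (N i)] :
    ∀ᶠ x in nhds (skewLengths N c), ∀ e, 0 < x e := by
  rw [Filter.eventually_all]
  intro e
  exact (continuous_apply e).continuousAt.eventually_const_lt (skewLengths_pos hc e)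

theorem len_pos {x : Edge N → ℝ} (hx : ∀ e, 0 < x e) {p q : Vtx} (h : Adj p q) :
    0 < len x p q := by
  obtain ⟨e, he⟩ := len_of_ne x h.ne
  rw [he]; exact hx e

theorem continuous_len (p q : Vtx) : Continuous fun x : Edge N → ℝ => len x p q := by
  unfold len
  split_ifs <;> fun_prop

theorem differentiable_len (p q : Vtx) : Differentiable ℝ fun x : Edge N → ℝ => len x p q := by
  unfold len
  split_ifs <;> fun_prop

theorem linkPairs_det_real {k : ℝ} {d : Vtx} (hd : d ∈ dirs) {e : Vtx × Vtx}
    (he : e ∈ linkPairs d) :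
    k ^ 2 / 81 ^ 2 * (area d e.1 : ℝ) * (k ^ 2 / 81 ^ 2 * area d e.2) -
      (k ^ 2 / 81 ^ 2 * minor d e.1 e.2) ^ 2 = k ^ 4 * (gram d d / 81) := by
  have h : (area d e.1 : ℝ) * area d e.2 - minor d e.1 e.2 ^ 2 = gram d d * 81 ^ 3 := by
    exact_mod_cast linkPairs_det d hd e he
  linear_combination (k ^ 4 / 81 ^ 4) * h

/-! ### Variation of the face-diagonals of one type -/

/-- The curve of edge-lengths along which the squared length of the face-diagonals of type `j` grows
at the constant rate `k`. -/
def faceCurve (N : Fin 3 → ℕ) (c k : ℝ) (j : Fin 3) (τ : ℝ) : Edge N → ℝ :=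
  fun e => √(skewLengths N c e ^ 2 + τ * (k * if e.2 = faceDiag j then 1 else 0))

variable {c : ℝ} (k : ℝ) (j : Fin 3)

theorem faceCurve_zero (hc : 0 < c) : faceCurve N c k j 0 = skewLengths N c := by
  ext e
  simp [faceCurve, Real.sqrt_sq (skewLengths_pos hc e).le]

theorem len_faceCurve_sq {τ : ℝ} (hτ : ∀ e, 0 < faceCurve N c k j τ e)
    {p q : Vtx} (h : Adj p q) : len (faceCurve N c k j τ) p q ^ 2 =
      c ^ 2 * (gram (q - p) (q - p) / 81) + τ * (k * ind j (q - p)) := by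
  rw [← len_skew_sq (N := N) h]
  have hne : (Finset.univ.filter fun i => p i ≠ q i).Nonempty := by
    obtain ⟨i, hi⟩ := Function.ne_iff.1 h.ne
    exact ⟨i, by simpa using hi⟩
  rw [len, dif_pos hne, len, dif_pos hne]
  set e : Edge N := (fun i => ((min (p i) (q i) : ℤ) : ZMod (N i)),
    ⟨Finset.univ.filter fun i => p i ≠ q i, hne⟩) with he
  have hpos := Real.sqrt_pos.1 (hτ e)
  rw [faceCurve, Real.sq_sqrt hpos.le]
  congr 3
  have : (Finset.univ.filter fun i => (q - p) i ≠ 0) = Finset.univ.filter fun i => p i ≠ q i := by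
    ext i
    simp [sub_eq_zero, eq_comm]
  rw [ind, this]
  simp [he, faceDiag, Subtype.ext_iff]

theorem hasDerivAt_faceCurve (hc : 0 < c) : HasDerivAt (faceCurve N c k j)
    (fun e => k * (if e.2 = faceDiag j then 1 else 0) / (2 * skewLengths N c e)) 0 := by
  rw [hasDerivAt_pi]
  intro e
  have h := skewLengths_pos hc e
  have h1 : HasDerivAt (fun τ => skewLengths N c e ^ 2 +
      τ * (k * if e.2 = faceDiag j then 1 else 0)) (k * if e.2 = faceDiag j then 1 else 0) 0 := by
    simpa using ((hasDerivAt_id (0 : ℝ)).mul_const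
      (k * if e.2 = faceDiag j then (1 : ℝ) else 0)).const_add (skewLengths N c e ^ 2)
  have h2 := h1.sqrt (by simpa using h.ne')
  simpa [faceCurve, Real.sqrt_sq h.le] using h2

variable [∀ i, NeZero (N i)]

theorem differentiableAt_dihedral (hc : 0 < c) (p : Vtx) {d : Vtx} (hd : d ∈ dirs)
    {e : Vtx × Vtx} (he : e ∈ linkPairs d) :
    DifferentiableAt ℝ (fun x : Edge N → ℝ => dihedral x p (p + d) (p + e.1) (p + e.2))
      (skewLengths N c) := by
  have h := isLinkTriple hd he
  have hev := (eventually_pos (N := N) hc).mono fun x hx =>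
    dihedral_eq x (len_pos hx (adj_add (p := p) h.adj_d)) (len_pos hx (adj_add (p := p) h.adj_e))
      (len_pos hx (adj_add (p := p) h.adj_f))
  refine DifferentiableAt.congr_of_eventuallyEq ?_ hev
  have hl : ∀ p q, DifferentiableAt ℝ (fun x : Edge N → ℝ => len x p q) (skewLengths N c) :=
    fun p q => differentiable_len p q _
  have hP : ∀ e ∈ linkDirs d, 0 < sqArea (len (skewLengths N c) p (p + d) ^ 2)
      (len (skewLengths N c) p (p + e) ^ 2) (len (skewLengths N c) (p + d) (p + e) ^ 2) := by
    intro e he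
    have h1 : (0 : ℝ) < area d e := by exact_mod_cast area_pos hd he
    obtain ⟨h2, h3⟩ := mem_linkDirs.1 he
    rw [len_skew_base_sq hd, len_skew_base_sq h2, len_skew_add_sq h3, sqArea_gram]
    positivity
  have hm := (mem_linkPairs.1 he).1
  have hP1 := hP _ hm.1
  have hP2 := hP _ hm.2
  refine differentiableAt_arccos_minor ?_ ?_ ?_ hP1 hP2 ?_
  · unfold sqMinor; fun_prop
  · unfold sqArea; fun_prop
  · unfold sqArea; fun_prop
  · rw [len_skew_base_sq hd, len_skew_base_sq h.adj_e, len_skew_base_sq h.adj_f,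
      len_skew_add_sq h.adj_de, len_skew_add_sq h.adj_df, len_skew_add_sq h.adj_ef,
      sqArea_gram, sqArea_gram, sqMinor_gram, linkPairs_det_real hd he]
    have : (0 : ℝ) < gram d d := by exact_mod_cast gram_self_pos hd
    positivity

theorem differentiableAt_deficit (hc : 0 < c) (p : Vtx) {d : Vtx} (hd : d ∈ dirs) :
    DifferentiableAt ℝ (fun x : Edge N → ℝ => deficit x p (p + d)) (skewLengths N c) := by
  simp only [deficit_eq]
  exact (differentiableAt_const _).sub
    (DifferentiableAt.fun_sum fun e he => differentiableAt_dihedral hc p hd he)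

theorem eventually_faceCurve_pos (hc : 0 < c) : ∀ᶠ τ in nhds 0, ∀ e, 0 < faceCurve N c k j τ e := by
  have h := (hasDerivAt_faceCurve (N := N) k j hc).continuousAt.tendsto
  rw [faceCurve_zero k j hc] at h
  exact h.eventually (eventually_pos hc)

theorem hasDerivAt_dihedral (hc : 0 < c) (p : Vtx) {d : Vtx} (hd : d ∈ dirs)
    {e : Vtx × Vtx} (he : e ∈ linkPairs d) :
    HasDerivAt (fun τ => dihedral (faceCurve N c k j τ) p (p + d) (p + e.1) (p + e.2))
      (-(k / (162 * c ^ 2) / √(gram d d / 81) * (minorVar j d e.1 e.2 - minor d e.1 e.2 / 2 *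
        (areaVar j d e.1 / area d e.1 + areaVar j d e.2 / area d e.2)))) 0 := by
  have h := isLinkTriple hd he
  have hev := (eventually_faceCurve_pos (N := N) k j hc).mono fun τ hτ => by
    have := dihedral_eq _ (len_pos hτ (adj_add (p := p) h.adj_d))
      (len_pos hτ (adj_add (p := p) h.adj_e)) (len_pos hτ (adj_add (p := p) h.adj_f))
    rw [len_faceCurve_sq k j hτ (adj_add h.adj_d), len_faceCurve_sq k j hτ (adj_add h.adj_e),
      len_faceCurve_sq k j hτ (adj_add h.adj_f),
      len_faceCurve_sq k j hτ ((adj_add_left p).2 h.adj_de),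
      len_faceCurve_sq k j hτ ((adj_add_left p).2 h.adj_df),
      len_faceCurve_sq k j hτ ((adj_add_left p).2 h.adj_ef)] at this
    simp only [add_sub_cancel_left, add_sub_add_left_eq_sub] at this
    exact this
  refine HasDerivAt.congr_of_eventuallyEq ?_ hev
  have hm := (mem_linkPairs.1 he).1
  have hA1 : (0 : ℝ) < area d e.1 := by exact_mod_cast area_pos hd hm.1
  have hA2 : (0 : ℝ) < area d e.2 := by exact_mod_cast area_pos hd hm.2
  have hg : (0 : ℝ) < gram d d := by exact_mod_cast gram_self_pos hd
  have lin : ∀ a b : ℝ, HasDerivAt (fun τ => a + τ * b) b 0 := fun a b => by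
    simpa using ((hasDerivAt_id (0 : ℝ)).mul_const b).const_add a
  have lin2 : ∀ a b a' b' a'' b'' : ℝ, HasDerivAt
      (fun τ => ((a + τ * b) + (a' + τ * b') - (a'' + τ * b'')) / 2) ((b + b' - b'') / 2) 0 :=
    fun a b a' b' a'' b'' => (((lin a b).add (lin a' b')).sub (lin a'' b'')).div_const 2
  have hP : ∀ e : Vtx, HasDerivAt (fun τ => sqArea (c ^ 2 * (gram d d / 81) + τ * (k * ind j d))
      (c ^ 2 * (gram e e / 81) + τ * (k * ind j e))
      (c ^ 2 * (gram (e - d) (e - d) / 81) + τ * (k * ind j (e - d))))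
      (k * c ^ 2 / 162 * areaVar j d e) 0 := by
    intro e
    refine (((lin _ _).mul (lin _ _)).sub ((lin2 _ _ _ _ _ _).pow 2)).congr_deriv ?_
    rw [gram_sub]
    simp only [areaVar, gramVar, sub_self, ind_zero]
    push_cast
    ring
  have hX : HasDerivAt (fun τ => sqMinor (c ^ 2 * (gram d d / 81) + τ * (k * ind j d))
      (c ^ 2 * (gram e.1 e.1 / 81) + τ * (k * ind j e.1))
      (c ^ 2 * (gram e.2 e.2 / 81) + τ * (k * ind j e.2))
      (c ^ 2 * (gram (e.1 - d) (e.1 - d) / 81) + τ * (k * ind j (e.1 - d)))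
      (c ^ 2 * (gram (e.2 - d) (e.2 - d) / 81) + τ * (k * ind j (e.2 - d)))
      (c ^ 2 * (gram (e.2 - e.1) (e.2 - e.1) / 81) + τ * (k * ind j (e.2 - e.1))))
      (k * c ^ 2 / 162 * minorVar j d e.1 e.2) 0 := by
    refine (((lin2 _ _ _ _ _ _).mul (lin _ _)).sub
      ((lin2 _ _ _ _ _ _).mul (lin2 _ _ _ _ _ _))).congr_deriv ?_
    rw [gram_sub, gram_sub, gram_sub]
    simp only [minorVar, gramVar, sub_self, ind_zero]
    push_cast
    ring
  -- The radicand is `c ^ 8` times the squared unit length of `d`, whichever tetrahedron at the edge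
  -- is taken; its root is pulled out of the sum over the link later.
  have hdet := linkPairs_det_real (k := c ^ 2) hd he
  have hpos : 0 < (c ^ 2) ^ 4 * ((gram d d : ℝ) / 81) := by positivity
  refine (hasDerivAt_arccos_minor hX (hP e.1) (hP e.2) ?_ ?_ ?_).congr_deriv ?_
  all_goals simp only [zero_mul, add_zero, sqArea_gram, sqMinor_gram]
  · positivity
  · positivity
  · rw [hdet]; exact hpos
  · rw [hdet, Real.sqrt_mul (by positivity), show (c ^ 2) ^ 4 = (c ^ 4) ^ 2 by ring,
      Real.sqrt_sq (by positivity)]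
    have hs : 0 < √((gram d d : ℝ) / 81) := Real.sqrt_pos.2 (by positivity)
    generalize √((gram d d : ℝ) / 81) = s at *
    field_simp

theorem hasDerivAt_deficit (hc : 0 < c) (p : Vtx) {d : Vtx} (hd : d ∈ dirs) :
    HasDerivAt (fun τ => deficit (faceCurve N c k j τ) p (p + d))
      (k / c ^ 2 * (sgn d * √(gram d d / 81))) 0 := by
  simp only [deficit_eq]
  refine ((HasDerivAt.fun_sum fun e he => hasDerivAt_dihedral k j hc p hd he).const_sub
    (2 * Real.pi)).congr_deriv ?_
  rw [Finset.sum_neg_distrib, ← Finset.mul_sum, neg_neg]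
  have h : (∑ e ∈ linkPairs d, ((minorVar j d e.1 e.2 : ℝ) - minor d e.1 e.2 / 2 *
      (areaVar j d e.1 / area d e.1 + areaVar j d e.2 / area d e.2))) =
      2 * sgn d * gram d d := by exact_mod_cast sum_linkPairs_var d hd j
  rw [h]
  have hg : (0 : ℝ) < gram d d := by exact_mod_cast gram_self_pos hd
  have hs : 0 < √((gram d d : ℝ) / 81) := Real.sqrt_pos.2 (by positivity)
  have h2 : (gram d d : ℝ) = 81 * √((gram d d : ℝ) / 81) ^ 2 := by
    rw [Real.sq_sqrt (by positivity)]; ring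
  rw [show 2 * (sgn d : ℝ) * gram d d = 2 * sgn d * (81 * √((gram d d : ℝ) / 81) ^ 2) by
    rw [← h2]]
  generalize √((gram d d : ℝ) / 81) = s at *
  field_simp
  ring

end

/-! ### The intrinsic metric: its flat value and its bi-Lipschitz stability. -/

section

variable {N : Fin 3 → ℕ}

/-! ### Tetrahedra cover space -/

/-- The points of a tetrahedron, in block coordinates. -/
def tetSet (T : Fin 4 → Vtx) : Set (Fin 3 → ℝ) := place T '' stdSimplex ℝ (Fin 4)

/-- `place` as a linear map. -/
def placeLin (T : Fin 4 → Vtx) : (Fin 4 → ℝ) →ₗ[ℝ] (Fin 3 → ℝ) :=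
  Fintype.linearCombination ℝ fun k => vpt (T k)

theorem placeLin_apply (T : Fin 4 → Vtx) (a : Fin 4 → ℝ) : placeLin T a = place T a := by
  ext i
  simp [placeLin, place, Fintype.linearCombination_apply, vpt]

theorem tetSet_eq (T : Fin 4 → Vtx) : tetSet T = placeLin T '' stdSimplex ℝ (Fin 4) := by
  simp only [tetSet, placeLin_apply]

theorem isClosed_tetSet (T : Fin 4 → Vtx) : IsClosed (tetSet T) := by
  rw [tetSet_eq]
  exact ((isCompact_stdSimplex ℝ (Fin 4)).image
    (LinearMap.continuous_of_finiteDimensional _)).isClosed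

theorem convex_tetSet (T : Fin 4 → Vtx) : Convex ℝ (tetSet T) := by
  rw [tetSet_eq]
  exact (convex_stdSimplex ℝ (Fin 4)).linear_image _

/-- Order the fractional parts of the coordinates decreasingly and raise the coordinates of the
integer part by one in that order: this path is the tetrahedron, and successive differences of the
sorted fractional parts are the barycentric coordinates. -/
theorem exists_tet_mem (z : Fin 3 → ℝ) : ∃ T, IsTet T ∧ z ∈ tetSet T ∧
    ∀ k i, ⌊z i⌋ ≤ T k i ∧ T k i ≤ ⌊z i⌋ + 1 := by
  obtain ⟨σ, hσ⟩ : ∃ σ : Equiv.Perm (Fin 3), Antitone fun k => Int.fract (z (σ k)) :=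
    ⟨Tuple.sort fun i => -Int.fract (z i), fun a b hab => by
      have := Tuple.monotone_sort (fun i => -Int.fract (z i)) hab
      simpa using this⟩
  refine ⟨fun k i => ⌊z i⌋ + if (σ.symm i).val < k.val then 1 else 0, ?_, ?_, ?_⟩
  · intro j k hjk
    refine ⟨fun h => ?_, fun i => ?_⟩
    · have hj : j.val < 3 := by omega
      have := congrFun h (σ ⟨j.val, hj⟩)
      simp [hjk] at this
    · have : j.val < k.val := hjk
      dsimp only
      split_ifs <;> omega
  · have h01 := hσ (show (0 : Fin 3) ≤ 1 by decide)
    have h12 := hσ (show (1 : Fin 3) ≤ 2 by decide)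
    have h0 := Int.fract_lt_one (z (σ 0))
    have h2 := Int.fract_nonneg (z (σ 2))
    simp only at h01 h12
    refine ⟨![1 - Int.fract (z (σ 0)), Int.fract (z (σ 0)) - Int.fract (z (σ 1)),
      Int.fract (z (σ 1)) - Int.fract (z (σ 2)), Int.fract (z (σ 2))], ⟨fun k => ?_, ?_⟩, ?_⟩
    · fin_cases k <;> simp <;> linarith
    · simp [Fin.sum_univ_four]
    · ext i
      obtain ⟨k, rfl⟩ := σ.surjective i
      refine Eq.trans ?_ (Int.floor_add_fract (z (σ k)))
      simp only [place, Fin.sum_univ_four, Equiv.symm_apply_apply]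
      fin_cases k <;> simp [-Int.floor_add_fract] <;> ring
  · intro k i
    dsimp only
    split_ifs <;> constructor <;> omega

/-- The points `z + d / (n + 1)` lie in finitely many tetrahedra, so one of them contains infinitely
many of these points. It contains `z` because it is closed, and then a whole initial segment because
it is convex. -/
theorem exists_tet_germ (z d : Fin 3 → ℝ) : ∃ δ > 0, ∃ T, IsTet T ∧
    ∀ s : ℝ, 0 ≤ s → s ≤ δ → z + s • d ∈ tetSet T := by
  let t : ℕ → ℝ := fun n => 1 / ((n : ℝ) + 1)
  have ht0 : ∀ n, 0 < t n := fun n => Nat.one_div_pos_of_nat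
  have ht1 : ∀ n, t n ≤ 1 := fun n => by
    simp only [t]; rw [div_le_one (by positivity)]; linarith [Nat.cast_nonneg (α := ℝ) n]
  choose T hT hmem hb using fun n => exists_tet_mem (z + t n • d)
  let lo : Fin 4 → Vtx := fun _ i => ⌊z i - |d i|⌋
  let hi : Fin 4 → Vtx := fun _ i => ⌊z i + |d i|⌋ + 1
  have hab : ∀ n i, |t n * d i| ≤ |d i| := fun n i => by
    rw [abs_mul, abs_of_pos (ht0 n)]
    exact mul_le_of_le_one_left (abs_nonneg _) (ht1 n)
  have hIcc : ∀ n, T n ∈ Set.Icc lo hi := fun n =>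
    ⟨fun k i => (Int.floor_le_floor (by
        have := (abs_le.1 (hab n i)).1
        simp only [Pi.add_apply, Pi.smul_apply, smul_eq_mul]; linarith [neg_abs_le (d i)])).trans
        (hb n k i).1,
      fun k i => (hb n k i).2.trans (by
        simp only [hi]
        have : ⌊(z + t n • d) i⌋ ≤ ⌊z i + |d i|⌋ := Int.floor_le_floor (by
          have := (abs_le.1 (hab n i)).2
          simp only [Pi.add_apply, Pi.smul_apply, smul_eq_mul]; linarith)
        omega)⟩
  have : Finite (Set.Icc lo hi) := Set.finite_Icc lo hi
  obtain ⟨S, hS⟩ := Finite.exists_infinite_fiber fun n => (⟨T n, hIcc n⟩ : Set.Icc lo hi)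
  rw [Set.infinite_coe_iff] at hS
  have hfreq := Nat.frequently_atTop_iff_infinite.2 hS
  have hfreq' : ∃ᶠ n in Filter.atTop, z + t n • d ∈ tetSet S.1 := hfreq.mono fun n hn => by
    have : (⟨T n, hIcc n⟩ : Set.Icc lo hi) = S := hn
    rw [← this]; exact hmem n
  have hlim : Filter.Tendsto (fun n => z + t n • d) Filter.atTop (nhds z) := by
    have := (tendsto_one_div_add_atTop_nhds_zero_nat (𝕜 := ℝ)).smul_const d
    simpa only [zero_smul, add_zero] using this.const_add z
  have hz : z ∈ tetSet S.1 := (isClosed_tetSet S.1).mem_of_frequently_of_tendsto hfreq' hlim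
  obtain ⟨n, hn⟩ := hS.nonempty
  have hn' : (⟨T n, hIcc n⟩ : Set.Icc lo hi) = S := hn
  have hTS : T n = S.1 := congrArg Subtype.val hn'
  refine ⟨t n, ht0 n, S.1, hTS ▸ hT n, fun s hs hsn => ?_⟩
  have hend : z + t n • d ∈ tetSet S.1 := hTS ▸ hmem n
  have := (convex_tetSet S.1).add_smul_sub_mem hz hend
    (show s / t n ∈ Set.Icc (0 : ℝ) 1 from
      ⟨div_nonneg hs (ht0 n).le, (div_le_one (ht0 n)).2 hsn⟩)
  rw [add_sub_cancel_left, smul_smul, div_mul_cancel₀ _ (ht0 n).ne'] at this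
  exact this

/-! ### Lengths of chords -/

/-- The squared length of a displacement with barycentric coordinates `δ`. -/
def chordSq (x : Edge N → ℝ) (T : Fin 4 → Vtx) (δ : Fin 4 → ℝ) : ℝ :=
  -(1 / 2) * ∑ i, ∑ j, len x (T i) (T j) ^ 2 * δ i * δ j

theorem chord_eq (x : Edge N → ℝ) (T : Fin 4 → Vtx) (a b : Fin 4 → ℝ) :
    chord x T a b = √(chordSq x T (a - b)) := rfl

/-- Expand the squares: the terms with a single `‖w i‖ ^ 2` carry the factor `∑ i, δ i = 0`, and
only the inner products survive. -/
theorem sum_dist_sq {E : Type*} [NormedAddCommGroup E] [InnerProductSpace ℝ E] {ι : Type*}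
    [Fintype ι] (w : ι → E) (δ : ι → ℝ) (h : ∑ i, δ i = 0) :
    -(1 / 2) * ∑ i, ∑ j, ‖w j - w i‖ ^ 2 * δ i * δ j = ‖∑ i, δ i • w i‖ ^ 2 := by
  have e1 : ∑ i, ∑ j, ‖w j - w i‖ ^ 2 * δ i * δ j =
      ∑ i, ∑ j, (δ i * ‖w i‖ ^ 2) * δ j + ∑ i, ∑ j, δ i * (δ j * ‖w j‖ ^ 2) -
        2 * ∑ i, ∑ j, δ i * δ j * inner ℝ (w i) (w j) := by
    simp only [Finset.mul_sum, ← Finset.sum_add_distrib, ← Finset.sum_sub_distrib]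
    refine Finset.sum_congr rfl fun i _ => Finset.sum_congr rfl fun j _ => ?_
    rw [norm_sub_sq_real, real_inner_comm]; ring
  have e2 : ‖∑ i, δ i • w i‖ ^ 2 = ∑ i, ∑ j, δ i * δ j * inner ℝ (w i) (w j) := by
    rw [← real_inner_self_eq_norm_sq, sum_inner]
    refine Finset.sum_congr rfl fun i _ => ?_
    rw [inner_sum]
    refine Finset.sum_congr rfl fun j _ => ?_
    rw [inner_smul_left, inner_smul_right]; simp; ring
  rw [e1, e2, ← Finset.sum_mul_sum, ← Finset.sum_mul_sum, h]
  ring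

theorem IsTet.adj {T : Fin 4 → Vtx} (hT : IsTet T) {i j : Fin 4} (h : i ≠ j) :
    Adj (T i) (T j) := by
  rcases lt_or_gt_of_ne h with h | h
  · exact Or.inl (hT i j h)
  · exact Or.inr (hT j i h)

theorem chordSq_skew (c : ℝ) {T : Fin 4 → Vtx} (hT : IsTet T) {δ : Fin 4 → ℝ}
    (h : ∑ i, δ i = 0) :
    chordSq (skewLengths N c) T δ = c ^ 2 * ‖emb (place T δ)‖ ^ 2 := by
  have h1 := sum_dist_sq (fun i => edgeVec c (T i)) δ h
  have h2 : ∑ i, δ i • edgeVec c (T i) = c • emb (place T δ) := by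
    rw [← placeLin_apply, placeLin, Fintype.linearCombination_apply, map_sum, Finset.smul_sum]
    refine Finset.sum_congr rfl fun i _ => ?_
    rw [map_smul, edgeVec, smul_comm]
  rw [h2, norm_smul, mul_pow, Real.norm_eq_abs, sq_abs] at h1
  rw [← h1, chordSq]
  congr 1
  refine Finset.sum_congr rfl fun i _ => Finset.sum_congr rfl fun j _ => ?_
  congr 2
  by_cases hij : i = j
  · simp [hij, len_self]
  · rw [len_skew_sq (hT.adj hij), ← edgeVec_sub, norm_edgeVec_sq]

theorem place_sub (T : Fin 4 → Vtx) (a b : Fin 4 → ℝ) :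
    place T (a - b) = place T a - place T b := by
  simp only [← placeLin_apply, map_sub]

theorem sum_sub_eq_zero {a b : Fin 4 → ℝ} (ha : a ∈ stdSimplex ℝ (Fin 4))
    (hb : b ∈ stdSimplex ℝ (Fin 4)) : ∑ i, (a - b) i = 0 := by
  simp [ha.2, hb.2]

theorem chord_skew {c : ℝ} (hc : 0 < c) {T : Fin 4 → Vtx} (hT : IsTet T) {a b : Fin 4 → ℝ}
    (ha : a ∈ stdSimplex ℝ (Fin 4)) (hb : b ∈ stdSimplex ℝ (Fin 4)) :
    chord (skewLengths N c) T a b = c * ‖emb (place T a - place T b)‖ := by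
  rw [chord_eq, chordSq_skew c hT (sum_sub_eq_zero ha hb), place_sub, ← mul_pow,
    Real.sqrt_sq (by positivity)]

theorem chord_nonneg (x : Edge N → ℝ) (T : Fin 4 → Vtx) (a b : Fin 4 → ℝ) : 0 ≤ chord x T a b :=
  Real.sqrt_nonneg _

/-! ### The intrinsic metric of the flat skew triangulation -/

theorem PolyLine.cons_segment {c : ℝ} (hc : 0 < c) {T : Fin 4 → Vtx} (hT : IsTet T)
    {P P' Q : Fin 3 → ℝ} {s : ℝ} (hP : P ∈ tetSet T) (hP' : P' ∈ tetSet T)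
    (h : PolyLine (skewLengths N c) P' Q s) :
    PolyLine (skewLengths N c) P Q (c * ‖emb (P - P')‖ + s) := by
  obtain ⟨a, ha, rfl⟩ := hP
  obtain ⟨b, hb, rfl⟩ := hP'
  rw [← chord_skew (N := N) hc hT ha hb]
  exact PolyLine.cons T a b Q s hT ha hb h

theorem PolyLine.norm_le {c : ℝ} (hc : 0 < c) {P Q : Fin 3 → ℝ} {s : ℝ}
    (h : PolyLine (skewLengths N c) P Q s) : c * ‖emb (P - Q)‖ ≤ s := by
  induction h with
  | refl P => simp
  | cons T a b Q s hT ha hb h ih =>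
    rw [chord_skew hc hT ha hb]
    have := norm_add_le (emb (place T a - place T b)) (emb (place T b - Q))
    rw [← map_add, sub_add_sub_cancel] at this
    nlinarith

/-- Continuous induction from `Q` back to `P`, over the parameters from which the rest of the
segment is already a polygonal line of the right length. A forward germ shows that the infimum is
attained, a backward germ that it is `0`. -/
theorem polyLine_segment {c : ℝ} (hc : 0 < c) (P Q : Fin 3 → ℝ) :
    PolyLine (skewLengths N c) P Q (c * ‖emb (P - Q)‖) := by
  let γ : ℝ → Fin 3 → ℝ := fun t => P + t • (Q - P)
  let D : ℝ := c * ‖emb (P - Q)‖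
  have hγ : ∀ s t, s ≤ t → c * ‖emb (γ s - γ t)‖ = (t - s) * D := by
    intro s t hst
    have : γ s - γ t = (t - s) • (P - Q) := by
      simp only [γ]; module
    rw [this, map_smul, norm_smul, Real.norm_eq_abs, abs_of_nonneg (sub_nonneg.2 hst)]
    simp only [D]; ring
  let S : Set ℝ := {t | 0 ≤ t ∧ t ≤ 1 ∧ PolyLine (skewLengths N c) (γ t) Q ((1 - t) * D)}
  have step : ∀ s t T, 0 ≤ s → s ≤ t → t ∈ S → IsTet T → γ s ∈ tetSet T → γ t ∈ tetSet T →
      s ∈ S := by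
    intro s t T h0 hst ht hT hs ht'
    refine ⟨h0, hst.trans ht.2.1, ?_⟩
    have := PolyLine.cons_segment hc hT hs ht' ht.2.2
    rw [hγ s t hst] at this
    convert this using 1
    ring
  have h1 : (1 : ℝ) ∈ S := by
    refine ⟨zero_le_one, le_rfl, ?_⟩
    have : γ 1 = Q := by simp [γ]
    rw [this, sub_self, zero_mul]
    exact PolyLine.refl Q
  have hbdd : BddBelow S := ⟨0, fun t ht => ht.1⟩
  set m := sInf S with hm
  have hm0 : 0 ≤ m := le_csInf ⟨1, h1⟩ fun t ht => ht.1
  have hmS : m ∈ S := by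
    obtain ⟨δ, hδ, T, hT, hseg⟩ := exists_tet_germ (γ m) (Q - P)
    obtain ⟨t, ht, htm⟩ := exists_lt_of_csInf_lt ⟨1, h1⟩ (show sInf S < m + δ by linarith)
    have hmt : m ≤ t := csInf_le hbdd ht
    refine step m t T hm0 hmt ht hT (by simpa using hseg 0 le_rfl hδ.le) ?_
    have := hseg (t - m) (by linarith) (by linarith)
    convert this using 1
    simp only [γ]; module
  have hm_zero : m = 0 := by
    by_contra hne
    have hmpos : 0 < m := lt_of_le_of_ne hm0 (Ne.symm hne)
    obtain ⟨δ, hδ, T, hT, hseg⟩ := exists_tet_germ (γ m) (P - Q)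
    have hmin : 0 < min δ m := lt_min hδ hmpos
    have : m - min δ m ∈ S := by
      refine step _ m T (by linarith [min_le_right δ m]) (by linarith) hmS hT ?_
        (by simpa using hseg 0 le_rfl hδ.le)
      have := hseg (min δ m) hmin.le (min_le_left _ _)
      convert this using 1
      simp only [γ]; module
    have := csInf_le hbdd this
    linarith
  rw [hm_zero] at hmS
  have h0 := hmS.2.2
  simpa [γ, D] using h0

/-! ### Comparison of intrinsic metrics -/

theorem abs_coord_le (w : Fin 3 → ℝ) (i : Fin 3) : |w i| ≤ 2 * ‖emb w‖ := by
  have h := inner_emb w w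
  rw [real_inner_self_eq_norm_sq] at h
  refine abs_le_of_sq_le_sq ?_ (by positivity)
  rw [mul_pow, h]
  fin_cases i <;> simp
  · nlinarith [sq_nonneg (w 1 - w 0 / 3 - 2 / 9 * w 2), sq_nonneg (w 2 * 3 - w 0)]
  · nlinarith [sq_nonneg (w 1 / 3 - w 0 + w 2 / 3), sq_nonneg (w 1 / 3 - w 2),
      sq_nonneg (w 1 - w 0 / 3 - 2 / 9 * w 2), sq_nonneg (w 0 - w 2 / 3 - w 2)]
  · nlinarith [sq_nonneg (w 0 - w 2 / 3), sq_nonneg (w 1 - w 0 / 3 - 2 / 9 * w 2)]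

/-- Only the uniformity in `T` matters: one neighbourhood of the flat lengths then serves all
tetrahedra of the universal cover. -/
theorem sum_abs_le {T : Fin 4 → Vtx} (hT : IsTet T) {δ : Fin 4 → ℝ} (h : ∑ i, δ i = 0) :
    ∑ i, |δ i| ≤ 12 * ‖emb (place T δ)‖ := by
  have h01 := hT 0 1 (by decide)
  have h12 := hT 1 2 (by decide)
  have h23 := hT 2 3 (by decide)
  have h02 := hT 0 2 (by decide)
  have h03 := hT 0 3 (by decide)
  have h13 := hT 1 3 (by decide)
  have hw := abs_coord_le (place T δ)
  rw [Fin.sum_univ_four] at h ⊢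
  -- Along the upward path `T 0, ..., T 3` a coordinate jumps at most once. One that jumps at the
  -- first, second or third step reads off the tail sum of `δ` from that step on; each tail sum is
  -- at most `2 * ‖emb (place T δ)‖` and is used twice below, whence `12`.
  obtain ⟨i, hi⟩ := Function.ne_iff.1 h01.1
  obtain ⟨j, hj⟩ := Function.ne_iff.1 h12.1
  obtain ⟨k, hk⟩ := Function.ne_iff.1 h23.1
  have b1 : |δ 1 + δ 2 + δ 3| ≤ 2 * ‖emb (place T δ)‖ := by
    have e : place T δ i = δ 1 + δ 2 + δ 3 := by
      have a1 : T 1 i = T 0 i + 1 := by have := h01.2 i; omega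
      have a2 : T 2 i = T 0 i + 1 := by have := h12.2 i; have := h02.2 i; omega
      have a3 : T 3 i = T 0 i + 1 := by have := h13.2 i; have := h03.2 i; omega
      simp only [place, Fin.sum_univ_four, a1, a2, a3]
      push_cast
      linear_combination (T 0 i : ℝ) * h
    rw [← e]; exact hw i
  have b2 : |δ 2 + δ 3| ≤ 2 * ‖emb (place T δ)‖ := by
    have e : place T δ j = δ 2 + δ 3 := by
      have a1 : T 1 j = T 0 j := by have := h01.2 j; have := h12.2 j; have := h02.2 j; omega
      have a2 : T 2 j = T 0 j + 1 := by have := h12.2 j; omega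
      have a3 : T 3 j = T 0 j + 1 := by have := h23.2 j; have := h03.2 j; omega
      simp only [place, Fin.sum_univ_four, a1, a2, a3]
      push_cast
      linear_combination (T 0 j : ℝ) * h
    rw [← e]; exact hw j
  have b3 : |δ 3| ≤ 2 * ‖emb (place T δ)‖ := by
    have e : place T δ k = δ 3 := by
      have a2 : T 2 k = T 0 k := by have := h23.2 k; have := h02.2 k; have := h03.2 k; omega
      have a1 : T 1 k = T 0 k := by have := h01.2 k; have := h12.2 k; omega
      have a3 : T 3 k = T 0 k + 1 := by have := h23.2 k; omega
      simp only [place, Fin.sum_univ_four, a1, a2, a3]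
      push_cast
      linear_combination (T 0 k : ℝ) * h
    rw [← e]; exact hw k
  have e0 : δ 0 = -(δ 1 + δ 2 + δ 3) := by linarith
  have e1 : δ 1 = (δ 1 + δ 2 + δ 3) - (δ 2 + δ 3) := by ring
  have e2 : δ 2 = (δ 2 + δ 3) - δ 3 := by ring
  have c0 : |δ 0| = |δ 1 + δ 2 + δ 3| := by rw [e0, abs_neg]
  have c1 : |δ 1| ≤ |δ 1 + δ 2 + δ 3| + |δ 2 + δ 3| := by
    calc |δ 1| = |(δ 1 + δ 2 + δ 3) - (δ 2 + δ 3)| := by rw [← e1]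
      _ ≤ _ := abs_sub _ _
  have c2 : |δ 2| ≤ |δ 2 + δ 3| + |δ 3| := by
    calc |δ 2| = |(δ 2 + δ 3) - δ 3| := by rw [← e2]
      _ ≤ _ := abs_sub _ _
  linarith

theorem abs_chordSq_sub_le {x y : Edge N → ℝ} {κ : ℝ} (hκ : 0 ≤ κ)
    (h : ∀ e, |x e ^ 2 - y e ^ 2| ≤ κ) (T : Fin 4 → Vtx) (δ : Fin 4 → ℝ) :
    |chordSq x T δ - chordSq y T δ| ≤ κ / 2 * (∑ i, |δ i|) ^ 2 := by
  have hl : ∀ p q, |len x p q ^ 2 - len y p q ^ 2| ≤ κ := by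
    intro p q
    unfold len
    split_ifs
    · exact h _
    · simpa using hκ
  have e : chordSq x T δ - chordSq y T δ =
      -(1 / 2) * ∑ i, ∑ j, (len x (T i) (T j) ^ 2 - len y (T i) (T j) ^ 2) * δ i * δ j := by
    simp only [chordSq, ← mul_sub, ← Finset.sum_sub_distrib, ← sub_mul]
  rw [e, abs_mul, pow_two, Finset.sum_mul_sum]
  have : |∑ i, ∑ j, (len x (T i) (T j) ^ 2 - len y (T i) (T j) ^ 2) * δ i * δ j| ≤
      ∑ i, ∑ j, κ * (|δ i| * |δ j|) := by
    refine (Finset.abs_sum_le_sum_abs _ _).trans (Finset.sum_le_sum fun i _ =>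
      (Finset.abs_sum_le_sum_abs _ _).trans (Finset.sum_le_sum fun j _ => ?_))
    rw [abs_mul, abs_mul, mul_assoc]
    exact mul_le_mul_of_nonneg_right (hl _ _) (by positivity)
  simp only [← Finset.mul_sum] at this
  rw [show |(-(1 / 2) : ℝ)| = 1 / 2 by norm_num [abs_of_nonneg]]
  simp only [← Finset.mul_sum]
  linarith

theorem eventually_chord_compare {c : ℝ} (hc : 0 < c) [∀ i, NeZero (N i)] {η : ℝ} (h0 : 0 < η)
    (h1 : η ≤ 1) : ∀ᶠ x in nhds (skewLengths N c), ∀ T, IsTet T →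
      ∀ a ∈ stdSimplex ℝ (Fin 4), ∀ b ∈ stdSimplex ℝ (Fin 4),
      (1 - η) * chord (skewLengths N c) T a b ≤ chord x T a b ∧
        chord x T a b ≤ (1 + η) * chord (skewLengths N c) T a b := by
  -- With `κ = η * c ^ 2 / 72` the error bound `κ / 2 * (12 * ‖·‖) ^ 2` is exactly `η` times the
  -- flat squared chord.
  have hev : ∀ᶠ x in nhds (skewLengths N c), ∀ e, |x e ^ 2 - skewLengths N c e ^ 2| ≤
      η * c ^ 2 / 72 := by
    rw [Filter.eventually_all]
    intro e
    have hcont : Continuous fun x : Edge N → ℝ => |x e ^ 2 - skewLengths N c e ^ 2| := by fun_prop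
    have : (fun x : Edge N → ℝ => |x e ^ 2 - skewLengths N c e ^ 2|) (skewLengths N c) <
        η * c ^ 2 / 72 := by simp only [sub_self, abs_zero]; positivity
    exact (hcont.continuousAt.eventually_lt_const this).mono fun x hx => hx.le
  refine hev.mono fun x hx T hT a ha b hb => ?_
  have hs := sum_sub_eq_zero ha hb
  have h2 := abs_chordSq_sub_le (by positivity) hx T (a - b)
  have h3 := sum_abs_le hT hs
  have h4 := chordSq_skew (N := N) c hT hs
  have h5 : (∑ i, |(a - b) i|) ^ 2 ≤ (12 * ‖emb (place T (a - b))‖) ^ 2 := by gcongr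
  have h6 : |chordSq x T (a - b) - chordSq (skewLengths N c) T (a - b)| ≤
      η * chordSq (skewLengths N c) T (a - b) := by
    rw [h4] at h2 ⊢
    refine h2.trans ?_
    have : 0 ≤ η * c ^ 2 / 72 / 2 := by positivity
    nlinarith [mul_le_mul_of_nonneg_left h5 this]
  obtain ⟨h7, h8⟩ := abs_le.1 h6
  have h9 : 0 ≤ chordSq (skewLengths N c) T (a - b) := by rw [h4]; positivity
  simp only [chord_eq]
  constructor
  · refine Real.le_sqrt_of_sq_le ?_
    rw [mul_pow, Real.sq_sqrt h9]
    have : (1 - η) ^ 2 ≤ 1 - η := by nlinarith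
    nlinarith [mul_le_mul_of_nonneg_right this h9]
  · rw [Real.sqrt_le_left (by positivity), mul_pow, Real.sq_sqrt h9]
    nlinarith [mul_nonneg (mul_nonneg h0.le h0.le) h9, mul_nonneg h0.le h9]

theorem PolyLine.compare {x y : Edge N → ℝ} {k : ℝ}
    (h : ∀ T, IsTet T → ∀ a ∈ stdSimplex ℝ (Fin 4), ∀ b ∈ stdSimplex ℝ (Fin 4),
      chord y T a b ≤ k * chord x T a b) {P Q : Fin 3 → ℝ} {s : ℝ} (hs : PolyLine x P Q s) :
    ∃ s', PolyLine y P Q s' ∧ s' ≤ k * s := by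
  induction hs with
  | refl P => exact ⟨0, PolyLine.refl P, by simp⟩
  | cons T a b Q s hT ha hb _ ih =>
    obtain ⟨s', hs', hle⟩ := ih
    exact ⟨_, PolyLine.cons T a b Q s' hT ha hb hs', by
      have := h T hT a ha b hb
      rw [mul_add]; linarith⟩

theorem PolyLine.nonneg {x : Edge N → ℝ} {P Q : Fin 3 → ℝ} {s : ℝ} (hs : PolyLine x P Q s) :
    0 ≤ s := by
  induction hs with
  | refl P => exact le_rfl
  | cons T a b Q s hT ha hb _ ih => exact add_nonneg (chord_nonneg _ _ _ _) ih

theorem pathDist_skew {c : ℝ} (hc : 0 < c) (P Q : Fin 3 → ℝ) :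
    pathDist (skewLengths N c) P Q = c * ‖emb (P - Q)‖ :=
  IsLeast.csInf_eq ⟨polyLine_segment hc P Q, fun _ hs => PolyLine.norm_le hc hs⟩

/-- The comparison of chords passes to polygonal lines piece by piece, in both directions, so no
geodesic of the perturbed metric has to be known. The neighbourhood does not depend on `P` and `Q`.
-/
theorem eventually_pathDist_compare {c : ℝ} (hc : 0 < c) [∀ i, NeZero (N i)] {η : ℝ} (h0 : 0 < η)
    (h1 : η < 1) : ∀ᶠ x in nhds (skewLengths N c), ∀ P Q,
      (1 - η) * (c * ‖emb (P - Q)‖) ≤ pathDist x P Q ∧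
        pathDist x P Q ≤ (1 + η) * (c * ‖emb (P - Q)‖) := by
  refine (eventually_chord_compare hc h0 h1.le).mono fun x hx P Q => ?_
  have hη : 0 < 1 - η := by linarith
  obtain ⟨s, hs, hle⟩ := PolyLine.compare (k := 1 + η)
    (fun T hT a ha b hb => (hx T hT a ha b hb).2) (polyLine_segment (N := N) hc P Q)
  constructor
  · refine le_csInf ⟨s, hs⟩ fun s hs => ?_
    obtain ⟨s', hs', hle'⟩ := PolyLine.compare (y := skewLengths N c) (k := (1 - η)⁻¹)
      (fun T hT a ha b hb => by
        rw [le_inv_mul_iff₀ hη]; exact (hx T hT a ha b hb).1) hs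
    rw [le_inv_mul_iff₀ hη] at hle'
    exact (mul_le_mul_of_nonneg_left (hs'.norm_le hc) hη.le).trans hle'
  · exact (csInf_le ⟨0, fun s hs => PolyLine.nonneg hs⟩ hs).trans hle

end

/-! ### Volumes of dual cells and of capped cells at the flat triangulation. -/

section

variable {N : Fin 3 → ℕ}

open MeasureTheory

/-! ### The barycentric dual cell in a tetrahedron -/

theorem volume_preimage_comp_perm {n : ℕ} (σ : Equiv.Perm (Fin n)) (s : Set (Fin n → ℝ)) :
    volume ((fun l : Fin n → ℝ => l ∘ σ) ⁻¹' s) = volume s := by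
  have h := (volume_measurePreserving_piCongrLeft
    (fun _ : Fin n => ℝ) σ.symm).measure_preimage_equiv s
  rw [← h]
  congr 2
  ext l i
  obtain ⟨k, rfl⟩ := σ.symm.surjective i
  rw [MeasurableEquiv.piCongrLeft_apply_apply]
  simp

theorem volume_linear_eq {n : ℕ} {g : Fin n → ℝ} (hg : g ≠ 0) (k : ℝ) :
    volume {l : Fin n → ℝ | ∑ i, g i * l i = k} = 0 := by
  let f : (Fin n → ℝ) →ₗ[ℝ] ℝ := ∑ i, g i • LinearMap.proj i
  have hf : ∀ l, f l = ∑ i, g i * l i := fun l => by simp [f]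
  by_cases hne : ∃ l₀, f l₀ = k
  · obtain ⟨l₀, hl₀⟩ := hne
    have : {l : Fin n → ℝ | ∑ i, g i * l i = k} =
        (fun l => l + -l₀) ⁻¹' (LinearMap.ker f : Set _) := by
      ext l
      simp [← hf, hl₀, ← sub_eq_add_neg, sub_eq_zero]
    rw [this, measure_preimage_add_right]
    refine Measure.addHaar_submodule _ _ fun h => hg ?_
    rw [LinearMap.ker_eq_top] at h
    ext i
    have := LinearMap.congr_fun h (Pi.single i 1)
    rw [hf] at this
    simpa [Pi.single_apply] using this
  · rw [show {l : Fin n → ℝ | ∑ i, g i * l i = k} = ∅ by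
      ext l; simp [← hf]; exact fun h => hne ⟨l, h⟩]
    simp

/-- The six orderings of the coordinates cut `A` into congruent pieces that overlap only where two
coordinates agree. -/
theorem volume_eq_six_mul {A : Set (Fin 3 → ℝ)} (hA : MeasurableSet A)
    (hσ : ∀ (σ : Equiv.Perm (Fin 3)) l, l ∘ σ ∈ A ↔ l ∈ A) :
    volume A = 6 * volume (A ∩ {l | Monotone l}) := by
  have hmono : MeasurableSet {l : Fin 3 → ℝ | Monotone l} := by
    have : {l : Fin 3 → ℝ | Monotone l} = {l | l 0 ≤ l 1} ∩ {l | l 1 ≤ l 2} := by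
      ext l
      simp [Fin.monotone_iff_le_succ, Fin.forall_fin_two]
    rw [this]
    exact (measurableSet_le (by fun_prop) (by fun_prop)).inter
      (measurableSet_le (by fun_prop) (by fun_prop))
  let B : Equiv.Perm (Fin 3) → Set (Fin 3 → ℝ) :=
    fun σ => (fun l : Fin 3 → ℝ => l ∘ σ) ⁻¹' (A ∩ {l | Monotone l})
  have hB : ∀ σ, MeasurableSet (B σ) := fun σ =>
    (hA.inter hmono).preimage (measurable_pi_lambda _ fun i => measurable_pi_apply _)
  have hU : A = ⋃ σ, B σ := by
    ext l
    simp only [B, Set.mem_iUnion, Set.mem_preimage, Set.mem_inter_iff, hσ, Set.mem_ofPred_eq]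
    exact ⟨fun h => ⟨Tuple.sort l, h, Tuple.monotone_sort l⟩, fun ⟨_, h, _⟩ => h⟩
  have hdis : Pairwise (Function.onFun (AEDisjoint volume) B) := by
    intro σ τ hne
    refine measure_mono_null (t := ⋃ p : {p : Fin 3 × Fin 3 // p.1 ≠ p.2},
      {l | ∑ i, (Pi.single p.1.1 1 - Pi.single p.1.2 1 : Fin 3 → ℝ) i * l i = 0}) ?_ ?_
    · rintro l ⟨⟨-, h1⟩, ⟨-, h2⟩⟩
      have h3 := Tuple.unique_monotone h1 h2
      obtain ⟨i, hi⟩ : ∃ i, σ i ≠ τ i := by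
        by_contra! h
        exact hne (Equiv.ext h)
      refine Set.mem_iUnion.2 ⟨⟨(σ i, τ i), hi⟩, ?_⟩
      have := congrFun h3 i
      simp only [Function.comp_apply] at this
      simp [sub_mul, Finset.sum_sub_distrib, Pi.single_apply, this]
    · refine measure_iUnion_null fun p => volume_linear_eq (fun h => ?_) 0
      have := congrFun h p.1.1
      simp [p.2] at this
  conv_lhs => rw [hU]
  rw [measure_iUnion₀ hdis fun σ => (hB σ).nullMeasurableSet, tsum_fintype]
  simp only [B, volume_preimage_comp_perm]
  rw [Finset.sum_const, Finset.card_univ, Fintype.card_perm]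
  simp [Nat.factorial]

/-- The dual cell of the base vertex of a tetrahedron, in barycentric coordinates. -/
def dualCell : Set (Fin 3 → ℝ) := {l | ∀ i, 0 ≤ l i ∧ l i ≤ 1 - ∑ j, l j}

theorem comp_perm_mem_dualCell (σ : Equiv.Perm (Fin 3)) (l : Fin 3 → ℝ) :
    l ∘ σ ∈ dualCell ↔ l ∈ dualCell := by
  simp only [dualCell, Set.mem_ofPred_eq, Function.comp_apply, Equiv.sum_comp σ l]
  exact σ.forall_congr_left.trans (by simp)

theorem isClosed_dualCell : IsClosed dualCell := by
  simp only [dualCell, Set.ofPred_forall, Set.ofPred_and]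
  exact isClosed_iInter fun i => (isClosed_le (by fun_prop) (by fun_prop)).inter
    (isClosed_le (by fun_prop) (by fun_prop))

theorem dualCell_subset_Icc : dualCell ⊆ Set.Icc 0 1 := by
  intro l hl
  refine ⟨fun i => (hl i).1, fun i => (hl i).2.trans ?_⟩
  have : 0 ≤ ∑ j, l j := Finset.sum_nonneg fun j _ => (hl j).1
  simpa using this

theorem sum_le_one_of_mem_dualCell {l : Fin 3 → ℝ} (hl : l ∈ dualCell) : ∑ i, l i ≤ 1 := by
  have := (hl 0).1.trans (hl 0).2
  linarith

theorem volume_dualCell_ne_top : volume dualCell ≠ ⊤ :=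
  ((measure_mono dualCell_subset_Icc).trans_lt isCompact_Icc.measure_lt_top).ne

theorem volume_dualCell : volume dualCell = ENNReal.ofReal (1 / 24) := by
  have hcube := volume_eq_six_mul (A := Set.Icc (0 : Fin 3 → ℝ) 1) measurableSet_Icc (by
    intro σ l
    simp only [Set.mem_Icc, Pi.le_def, Function.comp_apply, Pi.zero_apply, Pi.one_apply]
    exact and_congr (σ.forall_congr_left.trans (by simp)) (σ.forall_congr_left.trans (by simp)))
  have hdual := volume_eq_six_mul isClosed_dualCell.measurableSet comp_perm_mem_dualCell
  -- For `u = K l` the conditions `0 ≤ u 0 ≤ u 1 ≤ u 2 ≤ 1` say `0 ≤ l 0 ≤ l 1 ≤ l 2 ≤ 1 - ∑ l`, so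
  -- `K` carries the ordered part of the dual cell to that of the unit cube.
  let K : Matrix (Fin 3) (Fin 3) ℝ := !![4, 0, 0; 1, 3, 0; 1, 1, 2]
  have hdet : LinearMap.det (Matrix.toLin' K) = 24 := by
    rw [LinearMap.det_toLin', Matrix.det_fin_three]
    simp [K]; norm_num
  have hpre : dualCell ∩ {l | Monotone l} =
      Matrix.toLin' K ⁻¹' (Set.Icc (0 : Fin 3 → ℝ) 1 ∩ {l | Monotone l}) := by
    ext l
    simp only [dualCell, Set.mem_inter_iff, Set.mem_ofPred_eq, Set.mem_preimage, Set.mem_Icc,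
      Pi.le_def, Fin.forall_fin_succ, Fin.monotone_iff_le_succ, Fin.sum_univ_three]
    simp [K, Matrix.toLin'_apply, Matrix.mulVec, dotProduct, Fin.sum_univ_three]
    constructor
    · rintro ⟨⟨⟨_, _⟩, ⟨_, _⟩, ⟨_, _⟩⟩, _, _⟩
      refine ⟨⟨⟨?_, ?_, ?_⟩, ?_, ?_, ?_⟩, ?_, ?_⟩ <;> linarith
    · rintro ⟨⟨⟨_, _, _⟩, _, _, _⟩, _, _⟩
      refine ⟨⟨⟨?_, ?_⟩, ⟨?_, ?_⟩, ⟨?_, ?_⟩⟩, ?_, ?_⟩ <;> linarith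
  rw [hdual, hpre, Measure.addHaar_preimage_linearMap _ (by rw [hdet]; norm_num), hdet,
    mul_left_comm, ← hcube, Real.volume_Icc_pi]
  simp

/-- The half of the dual cell on the nonnegative side of a plane through the base vertex. -/
def halfCell (g : Fin 3 → ℝ) : Set (Fin 3 → ℝ) := {l | l ∈ dualCell ∧ 0 ≤ ∑ i, g i * l i}

theorem isClosed_halfCell (g : Fin 3 → ℝ) : IsClosed (halfCell g) := by
  simp only [halfCell, Set.ofPred_and]
  exact isClosed_dualCell.inter (isClosed_le (by fun_prop) (by fun_prop))

theorem volume_halfCell_comp (g : Fin 3 → ℝ) (σ : Equiv.Perm (Fin 3)) :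
    volume.real (halfCell (g ∘ σ)) = volume.real (halfCell g) := by
  rw [Measure.real, Measure.real, ← volume_preimage_comp_perm σ (halfCell (g ∘ σ))]
  congr 2
  ext l
  have : ∑ i, (g ∘ σ) i * (l ∘ σ) i = ∑ i, g i * l i := Equiv.sum_comp σ fun i => g i * l i
  simp only [halfCell, Set.mem_preimage, Set.mem_ofPred_eq, comp_perm_mem_dualCell, this]

theorem volume_halfCell_add_neg {g : Fin 3 → ℝ} (hg : g ≠ 0) :
    volume.real (halfCell g) + volume.real (halfCell (-g)) = 1 / 24 := by
  have hU : dualCell = halfCell g ∪ halfCell (-g) := by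
    ext l
    simp only [halfCell, Set.mem_union, Set.mem_ofPred_eq, Pi.neg_apply, neg_mul,
      Finset.sum_neg_distrib, Left.nonneg_neg_iff]
    exact ⟨fun h => (le_total 0 (∑ i, g i * l i)).imp (⟨h, ·⟩) (⟨h, ·⟩),
      fun h => h.elim And.left And.left⟩
  have hdis : AEDisjoint volume (halfCell g) (halfCell (-g)) := by
    refine measure_mono_null (fun l hl => ?_) (volume_linear_eq hg 0)
    have h1 := hl.1.2
    have h2 := hl.2.2
    simp only [Pi.neg_apply, neg_mul, Finset.sum_neg_distrib, Left.nonneg_neg_iff] at h2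
    exact le_antisymm h2 h1
  have hfin : ∀ g, volume (halfCell g) ≠ ⊤ := fun g =>
    ne_top_of_le_ne_top volume_dualCell_ne_top (measure_mono fun l hl => hl.1)
  have h := measure_union₀ (isClosed_halfCell (-g)).measurableSet.nullMeasurableSet hdis
  rw [← hU, volume_dualCell] at h
  rw [Measure.real, Measure.real, ← ENNReal.toReal_add (hfin _) (hfin _), ← h,
    ENNReal.toReal_ofReal (by norm_num)]

/-! ### Volumes of the flat skew triangulation -/

theorem starTets_mem_dirs : ∀ t ∈ starTets, (t.1 ∈ dirs ∧ t.2.1 ∈ dirs ∧ t.2.2 ∈ dirs) ∧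
    Step t.1 t.2.1 ∧ Step t.2.1 t.2.2 ∧ Step t.1 t.2.2 := by
  intro t ht
  simpa [starTets] using ht

/-- The Gram determinant of a unimodular triple: every tetrahedron is a sixth of a block. -/
theorem starTets_det : ∀ t ∈ starTets, gram t.1 t.1 * gram t.2.1 t.2.1 * gram t.2.2 t.2.2
    + 2 * gram t.1 t.2.1 * gram t.2.1 t.2.2 * gram t.1 t.2.2
    - gram t.1 t.1 * gram t.2.1 t.2.2 ^ 2 - gram t.2.1 t.2.1 * gram t.1 t.2.2 ^ 2
    - gram t.2.2 t.2.2 * gram t.1 t.2.1 ^ 2 = 81 ^ 3 := by decide +kernel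

theorem starTets_card : starTets.card = 24 := by decide +kernel

/-- Guarantees that the cap planes are genuine planes in the coordinates of each tetrahedron, hence
null sets. -/
theorem starTets_gram_ne_zero : ∀ d ∈ dirs, ∀ t ∈ starTets,
    gram t.1 d ≠ 0 ∨ gram t.2.1 d ≠ 0 ∨ gram t.2.2 d ≠ 0 := by decide +kernel

theorem gram_comm (a b : Vtx) : gram a b = gram b a := by simp only [gram]; ring

theorem tetVol_skew {c : ℝ} (hc : 0 < c) {t : Vtx × Vtx × Vtx} (ht : t ∈ starTets) (v : Vtx) :
    tetVol (skewLengths N c) v (v + t.1) (v + t.2.1) (v + t.2.2) = c ^ 3 / 6 := by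
  obtain ⟨⟨h1, h2, h3⟩, h12, h23, h13⟩ := starTets_mem_dirs t ht
  have hdet := starTets_det t ht
  have hdet' : (gram t.1 t.1 * gram t.2.1 t.2.1 * gram t.2.2 t.2.2
    + 2 * gram t.1 t.2.1 * gram t.2.1 t.2.2 * gram t.1 t.2.2
    - gram t.1 t.1 * gram t.2.1 t.2.2 ^ 2 - gram t.2.1 t.2.1 * gram t.1 t.2.2 ^ 2
    - gram t.2.2 t.2.2 * gram t.1 t.2.1 ^ 2 : ℝ) = 81 ^ 3 := by exact_mod_cast hdet
  have key : Matrix.det (Matrix.of fun i j : Fin 3 =>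
    (len (skewLengths N c) v (![v + t.1, v + t.2.1, v + t.2.2] i) ^ 2 +
      len (skewLengths N c) v (![v + t.1, v + t.2.1, v + t.2.2] j) ^ 2
      - len (skewLengths N c) (![v + t.1, v + t.2.1, v + t.2.2] i)
        (![v + t.1, v + t.2.1, v + t.2.2] j) ^ 2) / 2) = (c ^ 3) ^ 2 := by
    rw [Matrix.det_fin_three]
    simp only [Matrix.of_apply, Matrix.cons_val_zero, Matrix.cons_val_one, Matrix.cons_val,
      len_self, len_skew_base_sq h1, len_skew_base_sq h2, len_skew_base_sq h3,
      len_skew_add_sq (Or.inl h12 : Adj _ _), len_skew_add_sq (Or.inl h23 : Adj _ _),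
      len_skew_add_sq (Or.inl h13 : Adj _ _), len_skew_add_sq (Or.inr h12 : Adj _ _),
      len_skew_add_sq (Or.inr h23 : Adj _ _), len_skew_add_sq (Or.inr h13 : Adj _ _), gram_sub,
      gram_comm t.2.1 t.1, gram_comm t.2.2 t.1, gram_comm t.2.2 t.2.1]
    push_cast
    linear_combination (c ^ 6 / 81 ^ 3) * hdet'
  rw [tetVol, key, Real.sqrt_sq (by positivity)]

theorem continuous_tetVol (p q r s : Vtx) :
    Continuous fun x : Edge N → ℝ => tetVol x p q r s := by
  have hl := continuous_len (N := N)
  unfold tetVol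
  refine (Real.continuous_sqrt.comp
    (Continuous.matrix_det (continuous_matrix fun i j => ?_))).div_const _
  exact ((((hl _ _).pow 2).add ((hl _ _).pow 2)).sub ((hl _ _).pow 2)).div_const _

theorem continuous_vertexVol (v : Vtx) : Continuous fun x : Edge N → ℝ => vertexVol x v := by
  unfold vertexVol
  exact continuous_const.mul (continuous_finsetSum _ fun t _ => continuous_tetVol _ _ _ _)

theorem vertexVol_skew {c : ℝ} (hc : 0 < c) (v : Vtx) :
    vertexVol (skewLengths N c) v = c ^ 3 := by
  rw [vertexVol, Finset.sum_congr rfl fun t ht => tetVol_skew hc ht v, Finset.sum_const,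
    starTets_card]
  ring

/-- The products of the edges of a tetrahedron with an edge vector. -/
def starGram (t : Vtx × Vtx × Vtx) (d : Vtx) : Fin 3 → ℝ :=
  ![gram t.1 d, gram t.2.1 d, gram t.2.2 d]

/-- The displacement with coordinates `l` in a tetrahedron at a vertex. -/
def starDisp (t : Vtx × Vtx × Vtx) (l : Fin 3 → ℝ) : Fin 3 → ℝ :=
  l 0 • vpt t.1 + l 1 • vpt t.2.1 + l 2 • vpt t.2.2

theorem starPoint_eq (v : Vtx) (t : Vtx × Vtx × Vtx) (l : Fin 3 → ℝ) :
    starPoint v t l = vpt v + starDisp t l := by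
  ext i
  simp [starPoint, place, starDisp, vpt, Fin.sum_univ_four, Fin.sum_univ_three]
  ring

theorem norm_starDisp_sub_sq (t : Vtx × Vtx × Vtx) (l : Fin 3 → ℝ) (d : Vtx) :
    ‖emb (starDisp t l - vpt d)‖ ^ 2 = ‖emb (starDisp t l)‖ ^ 2 + gram d d / 81
      - 2 * (∑ i, starGram t d i * l i) / 81 := by
  rw [map_sub, norm_sub_sq_real, ← real_inner_self_eq_norm_sq (emb (vpt d)), inner_emb_vpt]
  simp only [starDisp, map_add, map_smul, inner_add_left, inner_smul_left, inner_emb_vpt,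
    starGram, Fin.sum_univ_three]
  simp
  ring

/-- The function whose nonpositivity defines the cap at the base vertex. -/
def capLow (x : Edge N → ℝ) (v w : Vtx) (t : Vtx × Vtx × Vtx) (l : Fin 3 → ℝ) : ℝ :=
  pathDist x (starPoint v t l) (vpt w) ^ 2 -
    (pathDist x (starPoint v t l) (vpt v) ^ 2 + len x v w ^ 2)

/-- The function whose nonpositivity defines the cap at the other end. -/
def capHigh (x : Edge N → ℝ) (v w : Vtx) (t : Vtx × Vtx × Vtx) (l : Fin 3 → ℝ) : ℝ :=
  pathDist x (starPoint v t l) (vpt v) ^ 2 -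
    (pathDist x (starPoint v t l) (vpt w) ^ 2 + len x v w ^ 2)

theorem mem_cappedCell {x : Edge N → ℝ} {v w : Vtx} {t : Vtx × Vtx × Vtx} {l : Fin 3 → ℝ} :
    l ∈ cappedCell x v w t ↔ l ∈ dualCell ∧ capLow x v w t l ≤ 0 ∧ capHigh x v w t l ≤ 0 := by
  simp only [cappedCell, dualCell, capLow, capHigh, sub_nonpos, Set.mem_ofPred_eq]

theorem pathDist_starPoint_sq {c : ℝ} (hc : 0 < c) (v : Vtx) (t : Vtx × Vtx × Vtx)
    (l : Fin 3 → ℝ) : pathDist (skewLengths N c) (starPoint v t l) (vpt v) ^ 2 =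
      c ^ 2 * ‖emb (starDisp t l)‖ ^ 2 := by
  rw [pathDist_skew hc, starPoint_eq, add_sub_cancel_left, mul_pow]

theorem pathDist_starPoint_add_sq {c : ℝ} (hc : 0 < c) (v d : Vtx) (t : Vtx × Vtx × Vtx)
    (l : Fin 3 → ℝ) : pathDist (skewLengths N c) (starPoint v t l) (vpt (v + d)) ^ 2 =
      c ^ 2 * ‖emb (starDisp t l - vpt d)‖ ^ 2 := by
  rw [pathDist_skew hc, starPoint_eq, vpt_add, add_sub_add_left_eq_sub, mul_pow]

theorem capLow_skew {c : ℝ} (hc : 0 < c) (v : Vtx) {d : Vtx} (hd : d ∈ dirs)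
    (t : Vtx × Vtx × Vtx) (l : Fin 3 → ℝ) : capLow (skewLengths N c) v (v + d) t l =
      -(2 * c ^ 2 / 81) * ∑ i, starGram t d i * l i := by
  rw [capLow, pathDist_starPoint_sq hc, pathDist_starPoint_add_sq hc, len_skew_base_sq hd,
    norm_starDisp_sub_sq]
  ring

theorem capHigh_skew {c : ℝ} (hc : 0 < c) (v : Vtx) {d : Vtx} (hd : d ∈ dirs)
    (t : Vtx × Vtx × Vtx) (l : Fin 3 → ℝ) : capHigh (skewLengths N c) v (v + d) t l =
      2 * c ^ 2 / 81 * (∑ i, starGram t d i * l i - gram d d) := by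
  rw [capHigh, pathDist_starPoint_sq hc, pathDist_starPoint_add_sq hc, len_skew_base_sq hd,
    norm_starDisp_sub_sq]
  ring

theorem starGram_ne_zero {t : Vtx × Vtx × Vtx} (ht : t ∈ starTets) {d : Vtx} (hd : d ∈ dirs) :
    starGram t d ≠ 0 := by
  intro h
  have h0 := congrFun h 0
  have h1 := congrFun h 1
  have h2 := congrFun h 2
  simp [starGram] at h0 h1 h2
  rcases starTets_gram_ne_zero d hd t ht with h | h | h <;> contradiction

theorem starGram_sum_le {t : Vtx × Vtx × Vtx} (ht : t ∈ starTets) {d : Vtx} (hd : d ∈ dirs)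
    {l : Fin 3 → ℝ} (hl : l ∈ dualCell) : ∑ i, starGram t d i * l i ≤ gram d d := by
  obtain ⟨⟨h1, h2, h3⟩, -⟩ := starTets_mem_dirs t ht
  have hg : ∀ i, starGram t d i ≤ gram d d := by
    have h : ∀ e ∈ dirs, (gram e d : ℝ) ≤ gram d d := fun e he => by
      rw [gram_comm]; exact_mod_cast gram_le d hd e he
    intro i
    fin_cases i <;> simp [starGram, h, h1, h2, h3]
  have hpos : (0 : ℝ) < gram d d := by exact_mod_cast gram_self_pos hd
  calc ∑ i, starGram t d i * l i ≤ ∑ i, gram d d * l i :=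
        Finset.sum_le_sum fun i _ => mul_le_mul_of_nonneg_right (hg i) (hl i).1
    _ = gram d d * ∑ i, l i := by rw [Finset.mul_sum]
    _ ≤ gram d d := mul_le_of_le_one_right hpos.le (sum_le_one_of_mem_dualCell hl)

theorem cappedCell_skew {c : ℝ} (hc : 0 < c) (v : Vtx) {d : Vtx} (hd : d ∈ dirs)
    {t : Vtx × Vtx × Vtx} (ht : t ∈ starTets) :
    cappedCell (skewLengths N c) v (v + d) t = halfCell (starGram t d) := by
  ext l
  rw [mem_cappedCell, capLow_skew hc v hd, capHigh_skew hc v hd]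
  have hk : 0 < 2 * c ^ 2 / 81 := by positivity
  simp only [halfCell, Set.mem_ofPred_eq, neg_mul, Left.neg_nonpos_iff]
  rw [mul_nonneg_iff_of_pos_left hk]
  refine ⟨fun h => ⟨h.1, h.2.1⟩, fun h => ⟨h.1, h.2, ?_⟩⟩
  have := starGram_sum_le ht hd h.1
  exact mul_nonpos_of_nonneg_of_nonpos hk.le (by linarith)

theorem starTets_neg : ∀ t ∈ starTets, (-t.2.2, -t.2.1, -t.1) ∈ starTets := by
  intro t ht
  obtain ⟨⟨h1, h2, h3⟩, h12, h23, h13⟩ := starTets_mem_dirs t ht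
  have hneg : ∀ a b : Vtx, Step a b → Step (-b) (-a) := by
    rintro a b ⟨hne, h⟩
    refine ⟨fun h => hne (neg_injective h.symm), fun i => ?_⟩
    have := h i
    simp only [Pi.neg_apply]
    omega
  simp [starTets, neg_mem_dirs, *]

/-- Only the plane through `v` cuts the dual cell, and the star is centrally symmetric about `v`, so
exactly half of the volume `c ^ 3` remains. -/
theorem cappedVol_skew {c : ℝ} (hc : 0 < c) (v : Vtx) {d : Vtx} (hd : d ∈ dirs) :
    cappedVol (skewLengths N c) v (v + d) = c ^ 3 / 2 := by
  have h1 : cappedVol (skewLengths N c) v (v + d) =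
      c ^ 3 * ∑ t ∈ starTets, volume.real (halfCell (starGram t d)) := by
    rw [cappedVol, Finset.mul_sum]
    refine Finset.sum_congr rfl fun t ht => ?_
    rw [tetVol_skew hc ht, cappedCell_skew hc v hd ht]
    ring
  -- Negation reverses the upward order of the three vertices; `Fin.revPerm` undoes this in the
  -- coordinates.
  have h2 : ∑ t ∈ starTets, volume.real (halfCell (starGram t d)) =
      ∑ t ∈ starTets, volume.real (halfCell (-starGram t d)) := by
    refine Finset.sum_nbij' (fun t => (-t.2.2, -t.2.1, -t.1)) (fun t => (-t.2.2, -t.2.1, -t.1))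
      starTets_neg starTets_neg (by simp) (by simp) fun t _ => ?_
    rw [← volume_halfCell_comp _ Fin.revPerm]
    congr 2
    ext i
    fin_cases i <;> simp [starGram, gram] <;> ring
  have h3 : ∑ t ∈ starTets, volume.real (halfCell (starGram t d)) +
      ∑ t ∈ starTets, volume.real (halfCell (-starGram t d)) = 1 := by
    rw [← Finset.sum_add_distrib, Finset.sum_congr rfl fun t ht =>
      volume_halfCell_add_neg (starGram_ne_zero ht hd), Finset.sum_const, starTets_card]
    norm_num
  rw [h1]
  have : ∑ t ∈ starTets, volume.real (halfCell (starGram t d)) = 1 / 2 := by linarith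
  rw [this]; ring

theorem edgeVol_skew {c : ℝ} (hc : 0 < c) (p : Vtx) {d : Vtx} (hd : d ∈ dirs) :
    edgeVol (skewLengths N c) p (p + d) = c ^ 3 := by
  have h := cappedVol_skew (N := N) hc (p + d) (neg_mem_dirs hd)
  rw [add_neg_cancel_right] at h
  rw [edgeVol, cappedVol_skew hc p hd, h]
  ring

end

section

variable {N : Fin 3 → ℕ}

open MeasureTheory

/-! ### Continuity of the edge volumes -/

theorem abs_sq_sub_sq_le {a b η : ℝ} (hb : 0 ≤ b) (h0 : 0 < η) (h1 : η < 1)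
    (hl : (1 - η) * b ≤ a) (hu : a ≤ (1 + η) * b) : |a ^ 2 - b ^ 2| ≤ 3 * η * b ^ 2 := by
  have hl0 : 0 ≤ (1 - η) * b := mul_nonneg (by linarith) hb
  have h3 : ((1 - η) * b) ^ 2 ≤ a ^ 2 := by gcongr
  have h4 : a ^ 2 ≤ ((1 + η) * b) ^ 2 := by
    have := hl0.trans hl
    gcongr
  have hb2 := sq_nonneg b
  rw [abs_le]
  constructor
  · nlinarith [mul_nonneg (mul_nonneg h0.le h0.le) hb2, mul_nonneg h0.le hb2]
  · nlinarith [mul_nonneg (mul_nonneg h0.le (by linarith : 0 ≤ 1 - η)) hb2]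

theorem norm_starDisp_le (t : Vtx × Vtx × Vtx) {l : Fin 3 → ℝ} (hl : l ∈ dualCell) :
    ‖emb (starDisp t l)‖ ≤ ‖emb (vpt t.1)‖ + ‖emb (vpt t.2.1)‖ + ‖emb (vpt t.2.2)‖ := by
  have h := dualCell_subset_Icc hl
  have hs : ∀ i (u : EuclideanSpace ℝ (Fin 3)), ‖l i • u‖ ≤ ‖u‖ := fun i u => by
    rw [norm_smul, Real.norm_eq_abs, abs_of_nonneg (h.1 i)]
    exact mul_le_of_le_one_left (norm_nonneg u) (h.2 i)
  simp only [starDisp, map_add, map_smul]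
  exact norm_add₃_le.trans (add_le_add (add_le_add (hs _ _) (hs _ _)) (hs _ _))

variable [∀ i, NeZero (N i)]

theorem eventually_cap_close {c : ℝ} (hc : 0 < c) (v d : Vtx)
    (t : Vtx × Vtx × Vtx) {κ : ℝ} (hκ : 0 < κ) :
    ∀ᶠ x in nhds (skewLengths N c), ∀ l ∈ dualCell,
      |capLow x v (v + d) t l - capLow (skewLengths N c) v (v + d) t l| ≤ κ ∧
      |capHigh x v (v + d) t l - capHigh (skewLengths N c) v (v + d) t l| ≤ κ := by
  let B : ℝ := c * (‖emb (vpt t.1)‖ + ‖emb (vpt t.2.1)‖ + ‖emb (vpt t.2.2)‖ + ‖emb (vpt d)‖)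
  have hB : 0 ≤ B := by positivity
  -- The tolerance `κ` is split into `κ / 4` for each of the two squared distances and `κ / 2` for
  -- the squared edge-length; `B` bounds the flat distances that occur.
  let η : ℝ := min (1 / 2) (κ / (12 * (B ^ 2 + 1)))
  have hη0 : 0 < η := lt_min (by norm_num) (by positivity)
  have hη1 : η < 1 := (min_le_left _ _).trans_lt (by norm_num)
  have hη2 : 3 * η * B ^ 2 ≤ κ / 4 := by
    have : η ≤ κ / (12 * (B ^ 2 + 1)) := min_le_right _ _
    rw [le_div_iff₀ (by positivity)] at this
    nlinarith
  have hlen : ∀ᶠ x in nhds (skewLengths N c),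
      |len x v (v + d) ^ 2 - len (skewLengths N c) v (v + d) ^ 2| < κ / 2 := by
    have hcont : Continuous fun x : Edge N → ℝ =>
        |len x v (v + d) ^ 2 - len (skewLengths N c) v (v + d) ^ 2| :=
      (((continuous_len v (v + d)).pow 2).sub continuous_const).abs
    exact hcont.continuousAt.eventually_lt_const (by simpa using hκ)
  filter_upwards [eventually_pathDist_compare hc hη0 hη1, hlen] with x hx hlx l hl
  have key : ∀ Q, ‖emb (starPoint v t l - Q)‖ * c ≤ B →
      |pathDist x (starPoint v t l) Q ^ 2 - pathDist (skewLengths N c) (starPoint v t l) Q ^ 2| ≤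
        κ / 4 := by
    intro Q hQ
    obtain ⟨h1, h2⟩ := hx (starPoint v t l) Q
    rw [pathDist_skew hc]
    refine (abs_sq_sub_sq_le (by positivity) hη0 hη1 h1 h2).trans (le_trans ?_ hη2)
    have h3 : 0 ≤ c * ‖emb (starPoint v t l - Q)‖ := by positivity
    have h4 : c * ‖emb (starPoint v t l - Q)‖ ≤ B := by rwa [mul_comm]
    gcongr
  have hd := norm_starDisp_le t hl
  have hk1 := key (vpt v) (by
    rw [starPoint_eq, add_sub_cancel_left, mul_comm]
    exact mul_le_mul_of_nonneg_left (hd.trans (by simp)) hc.le)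
  have hk2 := key (vpt (v + d)) (by
    rw [starPoint_eq, vpt_add, add_sub_add_left_eq_sub, mul_comm, map_sub]
    exact mul_le_mul_of_nonneg_left ((norm_sub_le _ _).trans (by gcongr)) hc.le)
  simp only [capLow, capHigh]
  rw [abs_le] at hk1 hk2 ⊢
  rw [abs_lt] at hlx
  rw [abs_le]
  constructor <;> constructor <;> linarith [hk1.1, hk1.2, hk2.1, hk2.2, hlx.1, hlx.2]

/-- When the cap functions move by at most `κ`, the cell changes only inside `Z κ`, where a flat cap
function is at most `κ` in absolute value. These sets decrease to a union of two planes, so their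
volume tends to `0`. -/
theorem continuousAt_volume_cappedCell {c : ℝ} (hc : 0 < c) (v : Vtx) {d : Vtx} (hd : d ∈ dirs)
    {t : Vtx × Vtx × Vtx} (ht : t ∈ starTets) :
    ContinuousAt (fun x : Edge N → ℝ => volume.real (cappedCell x v (v + d) t))
      (skewLengths N c) := by
  let Z : ℝ → Set (Fin 3 → ℝ) := fun κ => {l | l ∈ dualCell ∧
    (|capLow (skewLengths N c) v (v + d) t l| ≤ κ ∨
      |capHigh (skewLengths N c) v (v + d) t l| ≤ κ)}
  have hZfin : ∀ κ, volume (Z κ) ≠ ⊤ := fun κ =>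
    ne_top_of_le_ne_top volume_dualCell_ne_top (measure_mono fun l hl => hl.1)
  have hZclosed : ∀ κ, IsClosed (Z κ) := fun κ => by
    simp only [Z, Set.ofPred_and, Set.ofPred_or, capLow_skew hc v hd, capHigh_skew hc v hd]
    exact isClosed_dualCell.inter ((isClosed_le (by fun_prop) (by fun_prop)).union
      (isClosed_le (by fun_prop) (by fun_prop)))
  have hZmono : ∀ i j : ℝ, 0 < i → i ≤ j → Z i ⊆ Z j := fun i j _ hij l hl =>
    ⟨hl.1, hl.2.imp (·.trans hij) (·.trans hij)⟩
  have hlim := tendsto_measure_biInter_gt (μ := volume) (s := Z) (a := 0)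
    (fun κ _ => (hZclosed κ).measurableSet.nullMeasurableSet) hZmono ⟨1, one_pos, hZfin 1⟩
  have hzero : volume (⋂ r > (0 : ℝ), Z r) = 0 := by
    have hg := starGram_ne_zero ht hd
    refine measure_mono_null (t := {l | ∑ i, starGram t d i * l i = 0} ∪
      {l | ∑ i, starGram t d i * l i = gram d d}) (fun l hl => ?_)
      (measure_union_null (volume_linear_eq hg _) (volume_linear_eq hg _))
    simp only [Set.mem_iInter] at hl
    have hk : 2 * c ^ 2 / 81 ≠ 0 := by positivity
    by_contra hne
    rw [Set.mem_union, not_or] at hne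
    have h1 : 0 < |capLow (skewLengths N c) v (v + d) t l| := by
      rw [abs_pos, capLow_skew hc v hd]
      exact mul_ne_zero (neg_ne_zero.2 hk) hne.1
    have h2 : 0 < |capHigh (skewLengths N c) v (v + d) t l| := by
      rw [abs_pos, capHigh_skew hc v hd]
      exact mul_ne_zero hk (sub_ne_zero.2 hne.2)
    rcases (hl _ (half_pos (lt_min h1 h2))).2 with h | h
    · linarith [min_le_left |capLow (skewLengths N c) v (v + d) t l|
        |capHigh (skewLengths N c) v (v + d) t l|]
    · linarith [min_le_right |capLow (skewLengths N c) v (v + d) t l|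
        |capHigh (skewLengths N c) v (v + d) t l|]
  rw [hzero] at hlim
  rw [ContinuousAt, Metric.tendsto_nhds]
  intro ε hε
  have hev : ∀ᶠ κ in nhdsWithin (0 : ℝ) (Set.Ioi 0), volume (Z κ) < ENNReal.ofReal ε :=
    hlim.eventually_lt_const (by simpa using hε)
  obtain ⟨κ, hκε, hκ⟩ := (hev.and self_mem_nhdsWithin).exists
  have hκ : 0 < κ := hκ
  have hκε : volume.real (Z κ) < ε := by
    rw [Measure.real]
    exact (ENNReal.toReal_lt_of_lt_ofReal hκε)
  have hfin : ∀ x : Edge N → ℝ, volume (cappedCell x v (v + d) t) ≠ ⊤ := fun x =>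
    ne_top_of_le_ne_top volume_dualCell_ne_top
      (measure_mono fun l hl => (mem_cappedCell.1 hl).1)
  filter_upwards [eventually_cap_close hc v d t hκ] with x hx
  have sub : ∀ x y : Edge N → ℝ, (cappedCell x v (v + d) t ⊆ cappedCell y v (v + d) t ∪ Z κ) →
      volume.real (cappedCell x v (v + d) t) ≤
        volume.real (cappedCell y v (v + d) t) + volume.real (Z κ) := fun x y h =>
    (measureReal_mono h ((measure_union_lt_top (hfin y).lt_top (hZfin κ).lt_top).ne)).trans
      (measureReal_union_le _ _)
  have h1 := sub x (skewLengths N c) fun l hl => by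
    obtain ⟨hl, h1, h2⟩ := mem_cappedCell.1 hl
    obtain ⟨h3, h4⟩ := hx l hl
    rw [abs_le] at h3 h4
    by_cases hz : l ∈ Z κ
    · exact Or.inr hz
    · refine Or.inl (mem_cappedCell.2 ⟨hl, ?_, ?_⟩) <;> by_contra! hcon <;>
        refine hz ⟨hl, ?_⟩
      · exact Or.inl (abs_le.2 ⟨by linarith, by linarith⟩)
      · exact Or.inr (abs_le.2 ⟨by linarith, by linarith⟩)
  have h2 := sub (skewLengths N c) x fun l hl => by
    obtain ⟨hl, h1, h2⟩ := mem_cappedCell.1 hl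
    obtain ⟨h3, h4⟩ := hx l hl
    rw [abs_le] at h3 h4
    by_cases hz : l ∈ Z κ
    · exact Or.inr hz
    · refine Or.inl (mem_cappedCell.2 ⟨hl, ?_, ?_⟩) <;> by_contra! hcon <;>
        refine hz ⟨hl, ?_⟩
      · exact Or.inl (abs_le.2 ⟨by linarith, by linarith⟩)
      · exact Or.inr (abs_le.2 ⟨by linarith, by linarith⟩)
  rw [Real.dist_eq, abs_lt]
  constructor <;> linarith

theorem continuousAt_cappedVol {c : ℝ} (hc : 0 < c) (v : Vtx) {d : Vtx} (hd : d ∈ dirs) :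
    ContinuousAt (fun x : Edge N → ℝ => cappedVol x v (v + d)) (skewLengths N c) := by
  unfold cappedVol
  refine tendsto_finsetSum _ fun t ht => ?_
  exact ((continuous_const.mul (continuous_tetVol _ _ _ _)).continuousAt.tendsto).mul
    (continuousAt_volume_cappedCell hc v hd ht)

theorem continuousAt_edgeVol {c : ℝ} (hc : 0 < c) (p : Vtx) {d : Vtx} (hd : d ∈ dirs) :
    ContinuousAt (fun x : Edge N → ℝ => edgeVol x p (p + d)) (skewLengths N c) := by
  have h := continuousAt_cappedVol (N := N) hc (p + d) (neg_mem_dirs hd)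
  rw [add_neg_cancel_right] at h
  exact (continuousAt_cappedVol hc p hd).add h

end

section

variable {N : Fin 3 → ℕ}

/-! ### Linearization of the flow -/

/-- The product rule at a zero of `g`: the increment of `h` is multiplied by `g = O(y - x)`, so it
contributes `o(y - x)` even if `h` is merely continuous. -/
theorem hasFDerivAt_mul_of_eq_zero {E : Type*} [NormedAddCommGroup E] [NormedSpace ℝ E]
    {h g : E → ℝ} {g' : E →L[ℝ] ℝ} {x : E} (hh : ContinuousAt h x) (hg : HasFDerivAt g g' x)
    (h0 : g x = 0) : HasFDerivAt (fun y => h y * g y) (h x • g') x := by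
  rw [hasFDerivAt_iff_isLittleO] at hg ⊢
  have h1 : (fun y => h y * (g y - g x - g' (y - x))) =o[nhds x] fun y => y - x := by
    simpa using hh.isBigO_one ℝ |>.mul_isLittleO hg.norm_right |>.norm_right
  have h2 : (fun y => (h y - h x) * g' (y - x)) =o[nhds x] fun y => y - x := by
    have h3 : (fun y => h y - h x) =o[nhds x] fun _ => (1 : ℝ) := by
      rw [Asymptotics.isLittleO_one_iff]
      simpa using hh.tendsto.sub_const (h x)
    simpa using h3.mul_isBigO (g'.isBigO_sub (nhds x) x).norm_right |>.norm_right
  refine (h1.add h2).congr_left fun y => ?_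
  rw [h0]
  simp
  ring

/-- The length of an edge in direction `d` in the skew triangulation with blocks of unit volume. -/
def unitLen (d : Vtx) : ℝ := √(gram d d / 81)

theorem unitLen_sq (d : Vtx) (hd : d ∈ dirs) : unitLen d ^ 2 = gram d d / 81 := by
  have : (0 : ℝ) < gram d d := by exact_mod_cast gram_self_pos hd
  rw [unitLen, Real.sq_sqrt (by positivity)]

theorem unitLen_pos {d : Vtx} (hd : d ∈ dirs) : 0 < unitLen d := by
  have : (0 : ℝ) < gram d d := by exact_mod_cast gram_self_pos hd
  exact Real.sqrt_pos.2 (by positivity)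

theorem len_skew_base {c : ℝ} (hc : 0 < c) (p : Vtx) {d : Vtx} (hd : d ∈ dirs) :
    len (skewLengths N c) p (p + d) = c * unitLen d := by
  have h := unitLen_pos hd
  rw [← sq_eq_sq₀ (len_skew_pos hc (adj_add hd)).le (by positivity), len_skew_base_sq hd, mul_pow,
    unitLen_sq d hd]

theorem skewLengths_eq_unitLen (c : ℝ) (e : Edge N) :
    skewLengths N c e = c * unitLen (typeDir e.2) :=
  skewLengths_eq_sqrt e

theorem cosAngle_skew {c : ℝ} (hc : 0 < c) (p : Vtx) {d e : Vtx} (hd : d ∈ dirs) (he : e ∈ dirs)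
    (hde : Adj d e) : cosAngle (skewLengths N c) p (p + d) (p + e) =
      gram d e / (81 * (unitLen d * unitLen e)) := by
  have h1 := unitLen_pos hd
  have h2 := unitLen_pos he
  rw [cosAngle, len_skew_base_sq hd, len_skew_base_sq he, len_skew_add_sq hde,
    len_skew_base hc p hd, len_skew_base hc p he, gram_sub]
  push_cast
  field_simp
  ring

theorem max_zero_div_sq {a b : ℝ} (hb : 0 < b) : max 0 (a / b) ^ 2 = max 0 a ^ 2 / b ^ 2 := by
  have := max_div_div_right hb.le 0 a
  rw [zero_div] at this
  rw [this, div_pow]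

theorem continuousAt_cosAngle {c : ℝ} (hc : 0 < c) {o a b : Vtx} (ha : Adj o a) (hb : Adj o b) :
    ContinuousAt (fun x : Edge N → ℝ => cosAngle x o a b) (skewLengths N c) := by
  have hl := fun p q : Vtx => (continuous_len (N := N) p q).continuousAt (x := skewLengths N c)
  refine ContinuousAt.div ((((hl _ _).pow 2).add ((hl _ _).pow 2)).sub ((hl _ _).pow 2))
    ((continuousAt_const.mul (hl _ _)).mul (hl _ _)) ?_
  have h1 := len_skew_pos (N := N) hc ha
  have h2 := len_skew_pos (N := N) hc hb
  positivity

variable [∀ i, NeZero (N i)]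

/-- A function of the edge-lengths that vanishes at the flat skew triangulation and is
differentiable there, with derivative `D` along `faceCurve N c k j`. -/
structure FlatVariation (N : Fin 3 → ℕ) [∀ i, NeZero (N i)] (c k : ℝ) (j : Fin 3)
    (F : (Edge N → ℝ) → ℝ) (D : ℝ) : Prop where
  eq_zero : F (skewLengths N c) = 0
  differentiableAt : DifferentiableAt ℝ F (skewLengths N c)
  hasDerivAt : HasDerivAt (fun τ => F (faceCurve N c k j τ)) D 0

namespace FlatVariation

variable {c k : ℝ} {j : Fin 3} {F G : (Edge N → ℝ) → ℝ} {D D' : ℝ}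

theorem add (hF : FlatVariation N c k j F D) (hG : FlatVariation N c k j G D') :
    FlatVariation N c k j (fun x => F x + G x) (D + D') :=
  ⟨by rw [hF.eq_zero, hG.eq_zero, add_zero], hF.differentiableAt.add hG.differentiableAt,
    hF.hasDerivAt.add hG.hasDerivAt⟩

theorem sum {ι : Type*} {s : Finset ι} {F : ι → (Edge N → ℝ) → ℝ} {D : ι → ℝ}
    (h : ∀ i ∈ s, FlatVariation N c k j (F i) (D i)) :
    FlatVariation N c k j (fun x => ∑ i ∈ s, F i x) (∑ i ∈ s, D i) :=
  ⟨Finset.sum_eq_zero fun i hi => (h i hi).eq_zero,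
    DifferentiableAt.fun_sum fun i hi => (h i hi).differentiableAt,
    HasDerivAt.fun_sum fun i hi => (h i hi).hasDerivAt⟩

theorem mul_left (hc : 0 < c) {h : (Edge N → ℝ) → ℝ} (hh : ContinuousAt h (skewLengths N c))
    (hF : FlatVariation N c k j F D) :
    FlatVariation N c k j (fun x => h x * F x) (h (skewLengths N c) * D) := by
  refine ⟨by rw [hF.eq_zero, mul_zero],
    (hasFDerivAt_mul_of_eq_zero hh hF.differentiableAt.hasFDerivAt hF.eq_zero).differentiableAt, ?_⟩
  have h0 := faceCurve_zero (N := N) k j hc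
  have hcont : ContinuousAt (fun τ => h (faceCurve N c k j τ)) 0 := by
    refine ContinuousAt.comp (g := h) ?_ (hasDerivAt_faceCurve k j hc).continuousAt
    rwa [h0]
  have := hasFDerivAt_mul_of_eq_zero hcont hF.hasDerivAt.hasFDerivAt (by rw [h0, hF.eq_zero])
  exact this.hasDerivAt.congr_deriv (by simp [h0])

theorem congr (hF : FlatVariation N c k j F D) (h : ∀ x, G x = F x) :
    FlatVariation N c k j G D := by
  rwa [funext h]

theorem congr_deriv (hF : FlatVariation N c k j F D) (h : D = D') :
    FlatVariation N c k j F D' := h ▸ hF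

end FlatVariation

variable {c : ℝ} (k : ℝ) (j : Fin 3)

theorem flatVariation_deficit (hc : 0 < c) (p : Vtx) {d : Vtx} (hd : d ∈ dirs) :
    FlatVariation N c k j (fun x => deficit x p (p + d)) (k / c ^ 2 * (sgn d * unitLen d)) :=
  ⟨deficit_skew hc hd p, differentiableAt_deficit hc p hd, hasDerivAt_deficit k j hc p hd⟩

theorem flatVariation_scalarCurv (hc : 0 < c) (v : Vtx) :
    FlatVariation N c k j (fun x => scalarCurv x v) 0 := by
  have h1 : FlatVariation N c k j
      (fun x => ∑ d ∈ dirs, len x v (v + d) * deficit x v (v + d)) _ :=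
    FlatVariation.sum fun d hd => (flatVariation_deficit k j hc v hd).mul_left hc
      (continuous_len v (v + d)).continuousAt
  have h2 := h1.mul_left hc ((continuous_vertexVol (N := N) v).continuousAt.inv₀ (by
    rw [vertexVol_skew hc]; positivity))
  have h3 : ∑ d ∈ dirs, len (skewLengths N c) v (v + d) * (k / c ^ 2 * (sgn d * unitLen d)) =
      0 := by
    have h4 : ∀ d ∈ dirs, len (skewLengths N c) v (v + d) * (k / c ^ 2 * (sgn d * unitLen d)) =
        k / (81 * c) * (sgn d * gram d d : ℤ) := by
      intro d hd
      rw [len_skew_base hc v hd]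
      have h5 := unitLen_sq d hd
      push_cast
      field_simp
      rw [h5]
      ring
    rw [Finset.sum_congr rfl h4, ← Finset.mul_sum, ← Int.cast_sum, sum_dirs_sgn, Int.cast_zero,
      mul_zero]
  rw [h3, mul_zero] at h2
  simpa only [scalarCurv, div_eq_inv_mul, Pi.inv_apply] using h2

/-- The factor `max 0 cos` is part of the continuous coefficient, so the cut-off at right angles
does no harm to differentiability. -/
theorem flatVariation_secCurv_term (hc : 0 < c) (p : Vtx) {d e : Vtx} (hd : d ∈ dirs)
    (he : e ∈ dirs) (hde : Adj d e) :
    FlatVariation N c k j (fun x => 1 / 2 * len x p (p + e) *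
      max 0 (cosAngle x p (p + d) (p + e)) ^ 2 * deficit x p (p + e))
      (k / (162 * c * gram d d) * (sgn e * max 0 (gram d e) ^ 2 : ℤ)) := by
  refine ((flatVariation_deficit k j hc p he).mul_left hc
    ((continuousAt_const.mul (continuous_len p (p + e)).continuousAt).mul
      ((continuousAt_const.max (continuousAt_cosAngle hc (adj_add hd) (adj_add he))).pow
        2))).congr_deriv ?_
  have h1 := unitLen_pos hd
  have h2 := unitLen_pos he
  have h3 := unitLen_sq d hd
  have h4 : (gram d d : ℝ) = 81 * unitLen d ^ 2 := by rw [h3]; ring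
  simp only [Pi.mul_apply]
  rw [len_skew_base hc p he, cosAngle_skew hc p hd he hde, max_zero_div_sq (by positivity), h4]
  push_cast
  field_simp
  ring

theorem flatVariation_secCurv (hc : 0 < c) (p : Vtx) {d : Vtx} (hd : d ∈ dirs) :
    FlatVariation N c k j (fun x => secCurv x p (p + d))
      (k / c ^ 4 * (secSum d / (162 * gram d d))) := by
  have h0 := (flatVariation_deficit (N := N) k j hc p hd).mul_left hc
    (continuous_len p (p + d)).continuousAt
  have h1 : FlatVariation N c k j (fun x => ∑ e ∈ linkDirs d,
      (1 / 2 * len x p (p + e) * max 0 (cosAngle x p (p + d) (p + e)) ^ 2 * deficit x p (p + e)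
      + 1 / 2 * len x (p + d) (p + e) * max 0 (cosAngle x (p + d) p (p + e)) ^ 2 *
        deficit x (p + d) (p + e))) _ :=
    FlatVariation.sum (D := fun e => k / (162 * c * gram d d) * (sgn e * max 0 (gram d e) ^ 2 : ℤ) +
      k / (162 * c * gram d d) * (sgn (e - d) * max 0 (-gram d (e - d)) ^ 2 : ℤ)) fun e he => by
      -- Seen from the end `p + d`, the edge itself has direction `-d` and the third vertex of the
      -- triangle lies in direction `e - d`; the second summand is the first one for these
      -- directions.
      obtain ⟨he, hde⟩ := mem_linkDirs.1 he
      have hed : e - d ∈ dirs := adj_iff_sub_mem.1 hde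
      have hadj : Adj (-d) (e - d) := by
        rw [← adj_add_left d]
        simpa using adj_zero_of_mem_dirs he
      have h2 := flatVariation_secCurv_term (N := N) k j hc (p + d) (neg_mem_dirs hd) hed hadj
      rw [add_neg_cancel_right, gram_neg, show p + d + (e - d) = p + e by abel,
        show gram (-d) (e - d) = -gram d (e - d) by simp [gram]; ring] at h2
      exact (flatVariation_secCurv_term k j hc p hd he hde).add h2
  have h2 := (h0.add h1).mul_left hc ((continuousAt_edgeVol (N := N) hc p hd).inv₀ (by
    rw [edgeVol_skew hc p hd]; positivity))
  refine (h2.congr fun x => by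
    simp only [secCurv, div_eq_inv_mul, Pi.inv_apply, add_sub_cancel_left]).congr_deriv ?_
  simp only [Pi.inv_apply]
  have hl := unitLen_pos hd
  have h4 : (gram d d : ℝ) = 81 * unitLen d ^ 2 := by rw [unitLen_sq d hd]; ring
  simp only [← mul_add, ← Int.cast_add, ← Finset.mul_sum, ← Int.cast_sum]
  have h5 : (secSum d : ℝ) = 2 * sgn d * gram d d ^ 2 + (∑ e ∈ linkDirs d,
    (sgn e * max 0 (gram d e) ^ 2 + sgn (e - d) * max 0 (-gram d (e - d)) ^ 2) : ℤ) := by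
      rw [secSum]; push_cast; ring
  rw [h5]
  generalize (∑ e ∈ linkDirs d,
    (sgn e * max 0 (gram d e) ^ 2 + sgn (e - d) * max 0 (-gram d (e - d)) ^ 2) : ℤ) = S
  rw [edgeVol_skew hc p hd, len_skew_base hc p hd, h4]
  field_simp
  ring

theorem flatVariation_flow (hc : 0 < c) (e : Edge N) :
    FlatVariation N c k j (fun x => flow N x e)
      (k / c ^ 3 * (unitLen (typeDir e.2) * secSum (typeDir e.2) /
        (162 * gram (typeDir e.2) (typeDir e.2)))) := by
  have hd := typeDir_mem_dirs e.2
  have h1 := (flatVariation_scalarCurv (N := N) k j hc (tail e)).add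
    (flatVariation_scalarCurv k j hc (head e))
  have hx : ContinuousAt (fun x : Edge N → ℝ => x e) (skewLengths N c) :=
    (continuous_apply e).continuousAt
  have h2 := (h1.mul_left hc (h := fun x => -(1 / 4) * x e) (continuousAt_const.mul hx)).add
    ((flatVariation_secCurv k j hc (tail e) hd).mul_left hc hx)
  refine (h2.congr fun x => ?_).congr_deriv ?_
  · rw [flow, ricci, head_eq]
    ring
  · rw [skewLengths_eq_unitLen]
    field_simp
    ring

end

section

variable {N : Fin 3 → ℕ}

/-! ### The growth matrix of the face-diagonals -/

/-- Length of the face-diagonals in blocks of unit volume. -/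
def faceLen (i : Fin 3) : ℝ := unitLen (typeDir (faceDiag i))

/-- Response of the face-diagonals to a weighted mean of the perturbations. -/
def faceResponse (i : Fin 3) : ℝ := faceLen i * ![2018 / 11259, 2720 / 11502, 1602 / 9477] i

/-- The block sums of the coefficient matrix for blocks of unit volume. -/
def growthMatrix : Matrix (Fin 3) (Fin 3) ℝ := Matrix.vecMulVec faceResponse faceLen

/-- The largest eigenvalue of `growthMatrix`. -/
def growthRate : ℝ := 6340 / 6561

/-- An eigenvector of `growthMatrix`, of length close to `1`. -/
def growthVec (i : Fin 3) : ℝ := 2.267 * faceResponse i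

theorem faceLen_sq (i : Fin 3) : faceLen i ^ 2 = ![139 / 81, 142 / 81, 117 / 81] i := by
  rw [faceLen, unitLen_sq _ (typeDir_mem_dirs _), gram_faceDiag]
  fin_cases i <;> simp

theorem faceLen_dot_faceResponse : ∑ i, faceLen i * faceResponse i = growthRate := by
  have h0 := faceLen_sq 0
  have h1 := faceLen_sq 1
  have h2 := faceLen_sq 2
  simp only [Fin.sum_univ_three, faceResponse, growthRate]
  simp at h0 h1 h2 ⊢
  linear_combination 2018 / 11259 * h0 + 2720 / 11502 * h1 + 1602 / 9477 * h2

theorem growthMatrix_mulVec (q : Fin 3 → ℝ) :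
    growthMatrix *ᵥ q = (∑ i, faceLen i * q i) • faceResponse := by
  ext i
  simp only [growthMatrix, Matrix.mulVec, dotProduct, Matrix.vecMulVec_apply, Pi.smul_apply,
    smul_eq_mul, Finset.sum_mul]
  exact Finset.sum_congr rfl fun j _ => by ring

theorem growthMatrix_mulVec_growthVec : growthMatrix *ᵥ growthVec = growthRate • growthVec := by
  rw [growthMatrix_mulVec]
  have : ∑ i, faceLen i * growthVec i = 2.267 * growthRate := by
    rw [← faceLen_dot_faceResponse, Finset.mul_sum]
    exact Finset.sum_congr rfl fun j _ => by rw [growthVec]; ring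
  rw [this]
  ext i
  simp only [Pi.smul_apply, smul_eq_mul, growthVec]
  ring

theorem faceLen_bounds : (1.30998 ≤ faceLen 0 ∧ faceLen 0 ≤ 1.30999) ∧
    (1.32404 ≤ faceLen 1 ∧ faceLen 1 ≤ 1.32405) ∧ (1.20184 ≤ faceLen 2 ∧ faceLen 2 ≤ 1.20186) := by
  have hpos : ∀ i, 0 ≤ faceLen i := fun i => (unitLen_pos (typeDir_mem_dirs _)).le
  have h0 := faceLen_sq 0
  have h1 := faceLen_sq 1
  have h2 := faceLen_sq 2
  simp at h0 h1 h2
  have lo : ∀ i r, 0 ≤ r → r ^ 2 ≤ faceLen i ^ 2 → r ≤ faceLen i := fun i r hr h =>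
    (sq_le_sq₀ hr (hpos i)).1 h
  have hi : ∀ i r, 0 ≤ r → faceLen i ^ 2 ≤ r ^ 2 → faceLen i ≤ r := fun i r hr h =>
    (sq_le_sq₀ (hpos i) hr).1 h
  refine ⟨⟨lo _ _ ?_ ?_, hi _ _ ?_ ?_⟩, ⟨lo _ _ ?_ ?_, hi _ _ ?_ ?_⟩, lo _ _ ?_ ?_,
    hi _ _ ?_ ?_⟩ <;>
    norm_num [h0, h1, h2]

theorem growthMatrix_approx (i j : Fin 3) : |growthMatrix i j -
    !![0.308, 0.311, 0.282; 0.410, 0.415, 0.376; 0.266, 0.269, 0.244] i j| ≤ 0.0005 := by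
  obtain ⟨⟨a1, a2⟩, ⟨b1, b2⟩, c1, c2⟩ := faceLen_bounds
  have key : ∀ {x y x1 x2 y1 y2 : ℝ}, 0 ≤ x1 → 0 ≤ y1 → x1 ≤ x → x ≤ x2 → y1 ≤ y → y ≤ y2 →
      x1 * y1 ≤ x * y ∧ x * y ≤ x2 * y2 := fun hx hy h1 h2 h3 h4 =>
    ⟨mul_le_mul h1 h3 hy (hx.trans h1), mul_le_mul h2 h4 (hy.trans h3) (hx.trans (h1.trans h2))⟩
  have h00 := key (by norm_num) (by norm_num) a1 a2 a1 a2
  have h11 := key (by norm_num) (by norm_num) b1 b2 b1 b2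
  have h22 := key (by norm_num) (by norm_num) c1 c2 c1 c2
  have h01 := key (by norm_num) (by norm_num) a1 a2 b1 b2
  have h02 := key (by norm_num) (by norm_num) a1 a2 c1 c2
  have h12 := key (by norm_num) (by norm_num) b1 b2 c1 c2
  norm_num at h00 h11 h22 h01 h02 h12
  rw [abs_le]
  fin_cases i <;> fin_cases j <;>
    simp [growthMatrix, Matrix.vecMulVec_apply, faceResponse] <;> constructor <;> linarith

theorem growthVec_approx (i : Fin 3) : |growthVec i - ![0.532, 0.710, 0.461] i| ≤ 0.0005 := by
  obtain ⟨⟨a1, a2⟩, ⟨b1, b2⟩, c1, c2⟩ := faceLen_bounds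
  rw [abs_le]
  fin_cases i <;> simp [growthVec, faceResponse] <;> constructor <;> norm_num at * <;> linarith

theorem growthVec_zero_ne : growthVec 0 ≠ 0 := by
  have h := faceLen_bounds.1.1
  have : 0 < faceLen 0 := lt_of_lt_of_le (by norm_num) h
  have : 0 < growthVec 0 := by
    simp [growthVec, faceResponse]; positivity
  exact this.ne'

/-- Rank one: pair the eigenvector with `faceLen`. If the pairing `s` vanishes then `ν = 0`;
otherwise it cancels and leaves `ν = growthRate`. -/
theorem re_le_growthRate {ν : ℂ} (h : IsEigenvalue growthMatrix ν) : ν.re ≤ growthRate := by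
  obtain ⟨v, hv⟩ := h.exists_hasEigenvector
  have h1 := hv.apply_eq_smul
  rw [Matrix.toLin'_apply] at h1
  set s : ℂ := ∑ i, (faceLen i : ℂ) * v i with hs
  have h2 : ∀ i, (faceResponse i : ℂ) * s = ν * v i := fun i => by
    have := congrFun h1 i
    simp only [Matrix.mulVec, dotProduct, Matrix.map_apply, growthMatrix, Matrix.vecMulVec_apply,
      Pi.smul_apply, smul_eq_mul, Complex.ofReal_mul] at this
    rw [← this, hs, Finset.mul_sum]
    exact Finset.sum_congr rfl fun j _ => by ring
  have h3 : (growthRate : ℂ) * s = ν * s := by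
    rw [← faceLen_dot_faceResponse, Complex.ofReal_sum, Finset.sum_mul]
    conv_rhs => rw [hs, Finset.mul_sum]
    refine Finset.sum_congr rfl fun i _ => ?_
    rw [Complex.ofReal_mul, mul_assoc, h2]
    ring
  by_cases h0 : s = 0
  · obtain ⟨i, hi⟩ := Function.ne_iff.1 hv.2
    have := h2 i
    rw [h0, mul_zero, eq_comm, mul_eq_zero] at this
    rcases this with h | h
    · rw [h]; norm_num [growthRate]
    · exact absurd h hi
  · rw [← mul_right_cancel₀ h0 h3, Complex.ofReal_re]

theorem faceDiag_injective : Function.Injective faceDiag := by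
  intro i j h
  revert i j
  decide

theorem faceDiagVec_faceDiag (b : (i : Fin 3) → ZMod (N i)) (q : Fin 3 → ℝ) (i : Fin 3) :
    faceDiagVec N q (b, faceDiag i) = q i := by
  simp [faceDiagVec, faceDiag_injective.eq_iff]

theorem faceDiagVec_smul (a : ℝ) (q : Fin 3 → ℝ) :
    faceDiagVec N (a • q) = a • faceDiagVec N q := by
  ext e
  simp [faceDiagVec, Finset.mul_sum]

theorem faceDiagVec_eq_sum (q : Fin 3 → ℝ) :
    faceDiagVec N q = ∑ j, q j • faceDiagVec N (Pi.single j 1) := by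
  ext e
  simp only [faceDiagVec, Finset.sum_apply, Pi.smul_apply, smul_eq_mul, Finset.mul_sum]
  rw [Finset.sum_comm]
  refine Finset.sum_congr rfl fun i _ => ?_
  simp [Pi.single_apply]

variable [∀ i, NeZero (N i)]

theorem flow_skewLengths {c : ℝ} (hc : 0 < c) : flow N (skewLengths N c) = 0 := by
  ext e
  -- Only the value at the flat point is used, so the rate and the type are arbitrary.
  exact (flatVariation_flow 0 0 hc e).eq_zero

/-- The coefficient matrix of the piecewise flat Ricci flow at the flat skew triangulation. -/
def coeffMatrix (N : Fin 3 → ℕ) [∀ i, NeZero (N i)] (c : ℝ) : Matrix (Edge N) (Edge N) ℝ :=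
  LinearMap.toMatrix' (fderiv ℝ (flow N) (skewLengths N c)).toLinearMap

theorem differentiableAt_flow {c : ℝ} (hc : 0 < c) :
    DifferentiableAt ℝ (flow N) (skewLengths N c) := by
  rw [differentiableAt_pi]
  exact fun e => (flatVariation_flow 0 0 hc e).differentiableAt

theorem isCoeffMatrix {c : ℝ} (hc : 0 < c) :
    IsCoeffMatrix (flow N) (skewLengths N c) (coeffMatrix N c) := by
  rw [IsCoeffMatrix, coeffMatrix, Matrix.toLin'_toMatrix']
  exact (differentiableAt_flow hc).hasFDerivAt

theorem coeffMatrix_mulVec (c : ℝ) (v : Edge N → ℝ) :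
    coeffMatrix N c *ᵥ v = fderiv ℝ (flow N) (skewLengths N c) v := by
  rw [← Matrix.toLin'_apply, coeffMatrix, Matrix.toLin'_toMatrix']
  rfl

theorem coeffMatrix_mulVec_single {c : ℝ} (hc : 0 < c) (j : Fin 3) :
    coeffMatrix N c *ᵥ faceDiagVec N (Pi.single j 1) =
      (faceLen j / c ^ 2) • faceDiagVec N faceResponse := by
  -- The rate `k = 2 * c * faceLen j` of the squared length makes the face-diagonals of type `j`, of
  -- length `c * faceLen j`, grow at unit speed; the velocity of the curve is then the indicator
  -- vector of that type.
  have hj : 0 < faceLen j := unitLen_pos (typeDir_mem_dirs _)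
  have hcurve := hasDerivAt_faceCurve (N := N) (2 * c * faceLen j) j hc
  have htan : (fun e : Edge N => 2 * c * faceLen j * (if e.2 = faceDiag j then 1 else 0) /
      (2 * skewLengths N c e)) = faceDiagVec N (Pi.single j 1) := by
    ext e
    simp only [faceDiagVec, Pi.single_apply]
    by_cases h : e.2 = faceDiag j
    · rw [skewLengths_eq_unitLen, h]
      simp only [faceDiag_injective.eq_iff]
      change 2 * c * faceLen j * _ / (2 * (c * faceLen j)) = _
      simp
      field_simp
    · rw [if_neg h, mul_zero, zero_div, eq_comm]
      refine Finset.sum_eq_zero fun i _ => ?_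
      split_ifs with h1 h2
      · exact absurd (h2 ▸ h1) h
      · rfl
      · rfl
  rw [htan] at hcurve
  have h0 := faceCurve_zero (N := N) (2 * c * faceLen j) j hc
  have h1 : HasDerivAt (fun τ => flow N (faceCurve N c (2 * c * faceLen j) j τ))
      (coeffMatrix N c *ᵥ faceDiagVec N (Pi.single j 1)) 0 := by
    rw [coeffMatrix_mulVec]
    refine HasFDerivAt.comp_hasDerivAt (l := flow N) 0 ?_ hcurve
    rw [h0]
    exact (differentiableAt_flow hc).hasFDerivAt
  ext e
  rw [(hasDerivAt_pi.1 h1 e).unique (flatVariation_flow (2 * c * faceLen j) j hc e).hasDerivAt]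
  simp only [Pi.smul_apply, smul_eq_mul, faceDiagVec]
  rw [secSum_typeDir]
  by_cases h : ∃ i, e.2 = faceDiag i
  · obtain ⟨i, hi⟩ := h
    simp only [hi, faceDiag_injective.eq_iff, gram_faceDiag]
    change _ * (faceLen i * _ / _) = _
    rw [Finset.sum_ite_eq Finset.univ i faceResponse]
    fin_cases i <;> simp [faceResponse] <;> field_simp <;> ring
  · push Not at h
    simp [h]

theorem coeffMatrix_mulVec_faceDiagVec {c : ℝ} (hc : 0 < c) (q : Fin 3 → ℝ) :
    coeffMatrix N c *ᵥ faceDiagVec N q = (1 / c ^ 2) • faceDiagVec N (growthMatrix *ᵥ q) := by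
  rw [faceDiagVec_eq_sum, Matrix.mulVec_sum]
  simp only [Matrix.mulVec_smul, coeffMatrix_mulVec_single hc]
  rw [growthMatrix_mulVec, faceDiagVec_smul, smul_smul, Finset.mul_sum, Finset.sum_smul]
  refine Finset.sum_congr rfl fun j _ => ?_
  rw [smul_smul]
  congr 1
  ring

theorem coeffMatrix_mulVec_growthVec {c : ℝ} (hc : 0 < c) :
    coeffMatrix N c *ᵥ faceDiagVec N growthVec =
      (growthRate / c ^ 2) • faceDiagVec N growthVec := by
  rw [coeffMatrix_mulVec_faceDiagVec hc, growthMatrix_mulVec_growthVec, faceDiagVec_smul, smul_smul]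
  congr 1
  ring

/-- A sum of coefficients over one type is an entry of the matrix applied to the indicator vector of
that type, so individual entries are never computed. -/
theorem sum_faceDiagBlock {c : ℝ} (hc : 0 < c) (b : (i : Fin 3) → ZMod (N i)) (i j : Fin 3) :
    ∑ b', faceDiagBlock (coeffMatrix N c) (b, i) (b', j) = growthMatrix i j / c ^ 2 := by
  have h := congrFun (coeffMatrix_mulVec_single (N := N) hc j) (b, faceDiag i)
  rw [Pi.smul_apply, faceDiagVec_faceDiag] at h
  have h2 : growthMatrix i j / c ^ 2 = (faceLen j / c ^ 2) • faceResponse i := by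
    simp only [growthMatrix, Matrix.vecMulVec_apply, smul_eq_mul]; ring
  rw [h2, ← h, Matrix.mulVec, dotProduct, Fintype.sum_prod_type]
  refine Finset.sum_congr rfl fun b' _ => ?_
  have h3 : ∀ S, faceDiagVec N (Pi.single j 1) (b', S) = if S = faceDiag j then 1 else 0 := by
    intro S
    simp only [faceDiagVec]
    rw [Finset.sum_eq_single j (fun k _ hk => by simp [hk]) (by simp)]
    simp
  simp only [h3, mul_ite, mul_one, mul_zero, Finset.sum_ite_eq', Finset.mem_univ, if_true]
  rfl

theorem faceDiagBlock_mulVec {c : ℝ} (hc : 0 < c) :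
    faceDiagBlock (coeffMatrix N c) *ᵥ (fun e => growthVec e.2) =
      (growthRate / c ^ 2) • (fun e => growthVec e.2) := by
  ext ⟨b, i⟩
  rw [Matrix.mulVec, dotProduct, Fintype.sum_prod_type_right]
  simp only [← Finset.sum_mul, sum_faceDiagBlock hc]
  have := congrFun growthMatrix_mulVec_growthVec i
  rw [Matrix.mulVec, dotProduct] at this
  simp only [Pi.smul_apply, smul_eq_mul] at this ⊢
  rw [div_mul_eq_mul_div, ← this, Finset.sum_div]
  exact Finset.sum_congr rfl fun j _ => by ring

theorem linearlyUnstable {c : ℝ} (hc : 0 < c) :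
    LinearlyUnstable (flow N) (skewLengths N c) := by
  refine ⟨flow_skewLengths hc, coeffMatrix N c, isCoeffMatrix hc, ((growthRate / c ^ 2 : ℝ) : ℂ),
    ?_, ?_⟩
  · refine Module.End.hasEigenvalue_of_hasEigenvector
      (x := fun e => (faceDiagVec N growthVec e : ℂ)) ⟨?_, ?_⟩
    · rw [Module.End.mem_eigenspace_iff, Matrix.toLin'_apply]
      ext e
      have := congrArg (fun r : ℝ => (r : ℂ))
        (congrFun (coeffMatrix_mulVec_growthVec (N := N) hc) e)
      simpa [Matrix.mulVec, dotProduct] using this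
    · intro h
      have := congrFun h (0, faceDiag 0)
      rw [faceDiagVec_faceDiag] at this
      exact growthVec_zero_ne (by simpa using this)
  · rw [Complex.ofReal_re]
    have : 0 < growthRate := by norm_num [growthRate]
    positivity

theorem hasDerivAt_exp_smul {ι : Type*} [Fintype ι] {A : Matrix ι ι ℝ} {w : ι → ℝ} {r : ℝ}
    (h : A *ᵥ w = r • w) (s t : ℝ) : HasDerivAt (fun τ : ℝ => (s * Real.exp (r * τ)) • w)
      (A *ᵥ ((s * Real.exp (r * t)) • w)) t := by
  rw [Matrix.mulVec_smul, h, smul_smul]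
  have h1 : HasDerivAt (fun τ : ℝ => s * Real.exp (r * τ)) (s * Real.exp (r * t) * r) t := by
    have := (((hasDerivAt_id t).const_mul r).exp).const_mul s
    simpa [mul_assoc] using this
  exact h1.smul_const w

end

end SkewFlow

end

theorem theorem6 :
    ∃ (M : Matrix (Fin 3) (Fin 3) ℝ) (μ : ℝ) (p : Fin 3 → ℝ),
      -- numerical values, to three decimals
      (∀ i j, |M i j - !![0.308, 0.311, 0.282; 0.410, 0.415, 0.376; 0.266, 0.269, 0.244] i j|
        ≤ 0.0005) ∧
      0.966 ≤ μ ∧ μ ≤ 0.9665 ∧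
      (∀ i, |p i - ![0.532, 0.710, 0.461] i| ≤ 0.0005) ∧
      -- `μ` is the largest eigenvalue of `M`, with eigenvector `p`
      M *ᵥ p = μ • p ∧
      (∀ ν : ℂ, SkewFlow.IsEigenvalue M ν → ν.re ≤ μ) ∧
      -- for all grids of skew blocks of volume `c ^ 3`
      ∀ (N : Fin 3 → ℕ) [∀ i, NeZero (N i)] (c : ℝ), 0 < c →
        SkewFlow.LinearlyUnstable (SkewFlow.flow N) (SkewFlow.skewLengths N c) ∧
        ∃ A : Matrix (SkewFlow.Edge N) (SkewFlow.Edge N) ℝ,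
          SkewFlow.IsCoeffMatrix (SkewFlow.flow N) (SkewFlow.skewLengths N c) A ∧
          -- block sums by face-diagonal type
          (∀ (b : (i : Fin 3) → ZMod (N i)) (i j : Fin 3),
            ∑ b', SkewFlow.faceDiagBlock A (b, i) (b', j) = M i j / c ^ 2) ∧
          -- eigenvector of the face-diagonal coefficient matrix
          SkewFlow.faceDiagBlock A *ᵥ (fun e => p e.2) = (μ / c ^ 2) • (fun e => p e.2) ∧
          -- eigenvector of the coefficient matrix of all edges
          A *ᵥ SkewFlow.faceDiagVec N p = (μ / c ^ 2) • SkewFlow.faceDiagVec N p ∧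
          -- exponentially growing solutions of the linearized equations
          (∀ s t : ℝ, HasDerivAt
            (fun τ : ℝ => (s * Real.exp (μ / c ^ 2 * τ)) • SkewFlow.faceDiagVec N p)
            (A *ᵥ ((s * Real.exp (μ / c ^ 2 * t)) • SkewFlow.faceDiagVec N p)) t) := by
  refine ⟨SkewFlow.growthMatrix, SkewFlow.growthRate, SkewFlow.growthVec,
    SkewFlow.growthMatrix_approx, by norm_num [SkewFlow.growthRate],
    by norm_num [SkewFlow.growthRate], SkewFlow.growthVec_approx,
    SkewFlow.growthMatrix_mulVec_growthVec, fun ν hν => SkewFlow.re_le_growthRate hν,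
    fun N _ c hc => ⟨SkewFlow.linearlyUnstable hc, SkewFlow.coeffMatrix N c,
      SkewFlow.isCoeffMatrix hc, SkewFlow.sum_faceDiagBlock hc, SkewFlow.faceDiagBlock_mulVec hc,
      SkewFlow.coeffMatrix_mulVec_growthVec hc,
      SkewFlow.hasDerivAt_exp_smul (SkewFlow.coeffMatrix_mulVec_growthVec hc)⟩⟩
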